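/- Network synchronization model: for $i=1,\dots,N$, \[ \dot x_i = A x_i + B\Big(\alpha\sum_{j\ne i} g_{ij}(y_j-y_i)+\gamma_i w_i\Big),\qquad y_i = Cx_i, \] with $x_i\in\mathbb R^n$, $y_i,w_i\in\mathbb R^m$, real matrices $A\in\mathbb R^{n\times n}$, $B\in\mathbb R^{n\times m}$, $C\in\mathbb R^{m\times n}$, weights $g_{ij}\ge 0$ and $\alpha\in\mathbb R$. Its digraph on $\{1,\dots,N\}$ has an edge from $j$ to $i\neq j$ iff $g_{ij}>0$. A disturbance $w$ at a source $s$ means $\gamma_s=1$, $w_s=w$, and $\gamma_i=0$ for $i\ne s$; the disturbance satisfies the Dirichlet conditions (on every bounded interval of $[0,\infty)$ it is bounded and absolutely integrable, has finitely many discontinuities, and each component is piecewise monotone with finitely many pieces). The response is the solution with zero initial state, and $E_i(T)=\int_0^T y_i(t)^{T}y_i(t)\,dt$. A nonempty vertex set $\mathcal V_C$ is a separating cutset for $s$, with respect to a partition of the remaining vertices into $\mathcal V_1$ and $\mathcal V_B$, if no edge leads from $\mathcal V_1$ to $\mathcal V_B$ and $s\in\mathcal V_1\cup\mathcal V_C$.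 The synchronization manifold is $\{(x_1,\dots,x_N): x_1=\dots=x_N\}$; it is called asymptotically stable if for the undisturbed model it is Lyapunov stable and attractive (as a set). The model is called propagation stable if (1) the synchronization manifold is asymptotically stable, and (2) for every source $s$, every disturbance $w$ at $s$, every separating cutset $\mathcal V_C$ for $s$ with its $\mathcal V_1,\mathcal V_B$, every $T>0$ and every $b\in\mathcal V_B$, the response satisfies $E_b(T)\le\max_{c\in\mathcal V_C}E_c(T)$. For $i=1,\dots,N$ let $k_i=\alpha\sum_{j\ne i}g_{ij}$ and $H_i(s)=k_iC(sI-A+k_iBC)^{-1}B$, and let $\sigma_{\max}$ denote the largest singular value. Theorem. If the synchronization manifold is asymptotically stable and $\sup_{\omega\in\mathbb R}\sigma_{\max}(H_i(j\omega))\le 1$ for all $i=1,\dots,N$ (the supremum being over those $\omega$ for which $j\omega I-A+k_iBC$ is invertible), then the network synchronization model is propagation stable. -/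

import Mathlib

open Set Filter Topology MeasureTheory Matrix

/-- The data of a network synchronization model: `N` identical subsystems with state space `ℝⁿ`,
inputs and outputs in `ℝᵐ`, subsystem matrices `(A, B, C)`, coupling weights `g i j ≥ 0`
(`g i j` is the weight with which subsystem `j` influences subsystem `i`; only the off-diagonal
weights matter), and global coupling strength `α`. -/
structure NetworkModel (N n m : ℕ) where
  /-- state matrix of a subsystem -/
  A : Matrix (Fin n) (Fin n) ℝ
  /-- input matrix of a subsystem -/
  B : Matrix (Fin n) (Fin m) ℝ
  /-- output matrix of a subsystem -/
  C : Matrix (Fin m) (Fin n) ℝ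
  /-- coupling weights -/
  g : Matrix (Fin N) (Fin N) ℝ
  /-- global coupling strength -/
  α : ℝ
  g_nonneg : ∀ i j, i ≠ j → 0 ≤ g i j

namespace NetworkModel

variable {N n m : ℕ} (net : NetworkModel N n m)

/-- The network digraph: there is an edge from `j` to `i` iff `g i j > 0`. -/
def graph : Digraph (Fin N) where
  Adj j i := j ≠ i ∧ 0 < net.g i j

/-- The output `y i = C x i` of subsystem `i` when the network state is `x`. -/
noncomputable def output (x : Fin N → Fin n → ℝ) (i : Fin N) : Fin m → ℝ :=
  net.C *ᵥ x i

/-- The right-hand side of the network equations at network state `x` with external inputs `u`: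
component `i` is `A x i + B (α ∑_{j ≠ i} g i j (y j - y i) + u i)`. -/
noncomputable def vectorField (u : Fin N → Fin m → ℝ) (x : Fin N → Fin n → ℝ) :
    Fin N → Fin n → ℝ :=
  fun i => net.A *ᵥ x i +
    net.B *ᵥ (net.α • ∑ j ∈ Finset.univ.erase i,
      net.g i j • (net.output x j - net.output x i) + u i)

/-- `x` is a trajectory of the network on `[0, ∞)` with external inputs `u` (solution in the
sense of Carathéodory, so that `u` may be discontinuous). -/
def IsTrajectory (u : ℝ → Fin N → Fin m → ℝ) (x : ℝ → Fin N → Fin n → ℝ) : Prop :=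
  ContinuousOn x (Ici 0) ∧
    ∀ t, 0 ≤ t → x t = x 0 + ∫ τ in (0 : ℝ)..t, net.vectorField (u τ) (x τ)

/-- The synchronization manifold: all subsystems have the same state. -/
def syncManifold (N n : ℕ) : Set (Fin N → Fin n → ℝ) :=
  {x | ∀ i j, x i = x j}

/-- The synchronization manifold of the undisturbed network is asymptotically stable in the sense
of Lyapunov: it is stable and attractive. -/
def SyncAsymptoticallyStable : Prop :=
  (∀ ε > 0, ∃ δ > 0, ∀ x, net.IsTrajectory 0 x →
    Metric.infDist (x 0) (syncManifold N n) < δ →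
      ∀ t, 0 ≤ t → Metric.infDist (x t) (syncManifold N n) < ε) ∧
  (∃ δ > 0, ∀ x, net.IsTrajectory 0 x →
    Metric.infDist (x 0) (syncManifold N n) < δ →
      Tendsto (fun t => Metric.infDist (x t) (syncManifold N n)) atTop (𝓝 0))

/-- The Dirichlet conditions for a signal on `[0, ∞)`: on every bounded interval it is bounded,
absolutely integrable, has finitely many discontinuities and, in each component, finitely many
maxima and minima, i.e. it is piecewise monotone with finitely many pieces. -/
structure IsDirichlet (w : ℝ → Fin m → ℝ) : Prop where
  integrable : ∀ T, 0 < T → IntegrableOn w (Icc 0 T)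
  bounded : ∀ T, 0 < T → ∃ K : ℝ, ∀ t ∈ Icc 0 T, ∀ k, |w t k| ≤ K
  finite_discontinuities : ∀ T, 0 < T → {t ∈ Ioo 0 T | ¬ ContinuousAt w t}.Finite
  finite_extrema : ∀ T, 0 < T → ∀ k, ∃ S : Finset ℝ, ∀ a b : ℝ,
    Ioo a b ⊆ Ioo 0 T → Disjoint (Ioo a b) (S : Set ℝ) →
      MonotoneOn (fun t => w t k) (Ioo a b) ∨ AntitoneOn (fun t => w t k) (Ioo a b)

/-- The external input given by the disturbance `w` entering at the source `s` only
(`γ s = 1` and `γ i = 0` for `i ≠ s`). -/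
def sourceInput (s : Fin N) (w : ℝ → Fin m → ℝ) : ℝ → Fin N → Fin m → ℝ :=
  fun t i => if i = s then w t else 0

/-- `x` is the zero-state response of the network to the disturbance `w` at the source `s`. -/
def IsDisturbanceResponse (s : Fin N) (w : ℝ → Fin m → ℝ) (x : ℝ → Fin N → Fin n → ℝ) : Prop :=
  net.IsTrajectory (sourceInput s w) x ∧ x 0 = 0

/-- The output energy `E i (T) = ∫₀ᵀ (y i)ᵀ (y i) dt` of subsystem `i` along `x`. -/
noncomputable def energy (x : ℝ → Fin N → Fin n → ℝ) (T : ℝ) (i : Fin N) : ℝ :=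
  ∫ t in (0 : ℝ)..T, net.output (x t) i ⬝ᵥ net.output (x t) i

/-- `VC` is a separating cutset for the source `s`, as witnessed by the partition of the
remaining vertices into `V1` and `VB`: there are no edges from `V1` to `VB`, and `s` lies in
`V1 ∪ VC`. -/
structure IsSeparatingCutset (s : Fin N) (VC V1 VB : Finset (Fin N)) : Prop where
  nonempty : VC.Nonempty
  disjoint : Disjoint V1 VB
  union : V1 ∪ VB = VCᶜ
  no_edge : ∀ j ∈ V1, ∀ i ∈ VB, ¬ net.graph.Adj j i
  source_mem : s ∈ V1 ∪ VC

/-- Propagation stability of the network synchronization model. -/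
def PropagationStable : Prop :=
  net.SyncAsymptoticallyStable ∧
  ∀ (s : Fin N) (w : ℝ → Fin m → ℝ), IsDirichlet w →
    ∀ x, net.IsDisturbanceResponse s w x →
      ∀ (VC V1 VB : Finset (Fin N)) (h : net.IsSeparatingCutset s VC V1 VB),
        ∀ T, 0 < T → ∀ b ∈ VB, net.energy x T b ≤ VC.sup' h.nonempty (net.energy x T)

/-- The local gain `k i = α ∑_{j ≠ i} g i j`. -/
noncomputable def localGain (i : Fin N) : ℝ :=
  net.α * ∑ j ∈ Finset.univ.erase i, net.g i j

/-- The pencil `s I - A + k i B C`. -/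
noncomputable def localPencil (i : Fin N) (s : ℂ) : Matrix (Fin n) (Fin n) ℂ :=
  s • (1 : Matrix (Fin n) (Fin n) ℂ)
    - (net.A - net.localGain i • (net.B * net.C)).map Complex.ofReal

/-- The local feedback transfer matrix `H i (s) = k i C (s I - A + k i B C)⁻¹ B`. -/
noncomputable def localTransfer (i : Fin N) (s : ℂ) : Matrix (Fin m) (Fin m) ℂ :=
  (net.localGain i : ℂ) •
    (net.C.map Complex.ofReal * (net.localPencil i s)⁻¹ * net.B.map Complex.ofReal)

end NetworkModel

/-- The largest singular value of a complex matrix. -/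
noncomputable def sigmaMax {p q : ℕ} (M : Matrix (Fin p) (Fin q) ℂ) : ℝ :=
  (Matrix.toEuclideanLin M).singularValues 0

namespace NetworkModel

/-- `sup_ω σ_max (H i (jω))`, as an extended nonnegative real. The supremum is over the real
frequencies at which `H i (jω)` is defined, i.e. all but the finitely many `ω` for which `jω` is an
eigenvalue of `A - k i B C`; at a pole of `H i` on the imaginary axis it is therefore `∞`. -/
noncomputable def peakGain {N n m : ℕ} (net : NetworkModel N n m) (i : Fin N) : ENNReal :=
  ⨆ (ω : ℝ) (_ : IsUnit (net.localPencil i (ω * Complex.I))),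
    ENNReal.ofReal (sigmaMax (net.localTransfer i (ω * Complex.I)))

end NetworkModel

/-! Energy obeys a discrete maximum principle. Away from the source, a vertex `b` with `k_b ≠ 0`
satisfies `x_b' = (A - k_b BC) x_b + k_b B u_b`, where `u_b` is the average of the other outputs
with weights `α g_bj / k_b`, which are nonnegative and sum to one. If `A - k_b BC` is Hurwitz,
contractivity of `H_b` on the imaginary axis gives, through the bounded real lemma
`Matrix.IsHurwitz.integral_sum_norm_sq_le`, that the energy of `y_b` is at most that of `u_b`. By
convexity of the square it is then at most the weighted mean of the neighbours' energies
(`energy_le_sum`).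

If some vertex of `VB` had more energy than the whole cutset, the maximisers in `VB` could receive
coupling only from one another. They exclude the source, so they would stay at rest, although their
energy is positive.

The Hurwitz property (`isHurwitz_localGain`) is the other half. Synchronization makes `A - l BC`
Hurwitz for a Laplacian eigenvalue `l` that has a left eigenvector with zero sum. By Gershgorin, `l`
lies in a disc centred at some `k_i` with radius `|k_i|`. These discs are nested, so `l` lies in the
largest one, centred at `k_j`, whose interior contains `k_b`. Contractivity of `H_j` keeps the
eigenvalues of `A - c BC` off the imaginary axis for every `c` inside that disc. Moving `c` along
the segment from `l` to `k_b` therefore preserves stability.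

The bounded real lemma is proved by closing the motion up into a periodic one and applying Parseval.
-/

/-! ### Singular values and contractive matrices. -/

theorem LinearMap.norm_apply_le_singularValues_zero {𝕜 E F : Type*} [RCLike 𝕜]
    [NormedAddCommGroup E] [InnerProductSpace 𝕜 E] [FiniteDimensional 𝕜 E]
    [NormedAddCommGroup F] [InnerProductSpace 𝕜 F] [FiniteDimensional 𝕜 F]
    (T : E →ₗ[𝕜] F) (v : E) : ‖T v‖ ≤ T.singularValues 0 * ‖v‖ := by
  have hT := T.isSymmetric_adjoint_comp_self
  set b := hT.eigenvectorBasis rfl with hb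
  -- Expand `⟪T*T v, v⟫` in an orthonormal eigenbasis of `T*T`, whose eigenvalues are the squared
  -- singular values.
  have h1 : (‖T v‖ ^ 2 : ℝ) = ∑ i, hT.eigenvalues rfl i * ‖inner 𝕜 (b i) v‖ ^ 2 := by
    have h2 : ((‖T v‖ ^ 2 : ℝ) : 𝕜) =
        ((∑ i, hT.eigenvalues rfl i * ‖inner 𝕜 (b i) v‖ ^ 2 : ℝ) : 𝕜) := by
      have h3 : ((‖T v‖ ^ 2 : ℝ) : 𝕜) = inner 𝕜 ((adjoint T ∘ₗ T) v) v := by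
        rw [LinearMap.comp_apply, LinearMap.adjoint_inner_left, inner_self_eq_norm_sq_to_K]
        push_cast; rfl
      rw [h3, ← b.sum_inner_mul_inner, RCLike.ofReal_sum]
      refine Finset.sum_congr rfl fun i _ => ?_
      rw [RCLike.ofReal_mul, RCLike.ofReal_pow, hT v (b i), hb, hT.apply_eigenvectorBasis, inner_smul_right, mul_assoc, ← hb,
        ← inner_conj_symm v (b i), RCLike.conj_mul]
    exact_mod_cast h2
  have h4 : ‖T v‖ ^ 2 ≤ (T.singularValues 0 * ‖v‖) ^ 2 := by
    rw [h1, mul_pow, ← b.sum_sq_norm_inner_right v, Finset.mul_sum]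
    refine Finset.sum_le_sum fun i _ => ?_
    gcongr
    rw [← T.sq_singularValues_fin rfl i]
    exact pow_le_pow_left₀ (T.singularValues_nonneg _) (T.singularValues_antitone (Nat.zero_le _)) 2
  exact le_of_sq_le_sq h4 (mul_nonneg (T.singularValues_nonneg _) (norm_nonneg _))

theorem sum_norm_sq_mulVec_le_of_sigmaMax_le_one {p q : ℕ} {M : Matrix (Fin p) (Fin q) ℂ}
    (hM : sigmaMax M ≤ 1) (v : Fin q → ℂ) :
    ∑ i, ‖(M *ᵥ v) i‖ ^ 2 ≤ ∑ j, ‖v j‖ ^ 2 := by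
  have h := (Matrix.toEuclideanLin M).norm_apply_le_singularValues_zero (WithLp.toLp 2 v)
  have h' : ‖Matrix.toEuclideanLin M (WithLp.toLp 2 v)‖ ≤ ‖WithLp.toLp 2 v‖ :=
    h.trans (mul_le_of_le_one_left (norm_nonneg _) hM)
  have h2 := pow_le_pow_left₀ (norm_nonneg _) h' 2
  rw [EuclideanSpace.norm_sq_eq, EuclideanSpace.norm_sq_eq] at h2
  simpa using h2

/-- Test on a basis vector. The entrywise bound serves to keep determinants bounded near a possible
pole. -/
theorem norm_apply_le_one_of_sum_norm_sq_mulVec_le {p q : ℕ} {M : Matrix (Fin p) (Fin q) ℂ}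
    (hM : ∀ v : Fin q → ℂ, ∑ i, ‖(M *ᵥ v) i‖ ^ 2 ≤ ∑ j, ‖v j‖ ^ 2) (i : Fin p) (j : Fin q) :
    ‖M i j‖ ≤ 1 := by
  have h := hM (Pi.single j 1)
  have h1 : ‖M i j‖ ^ 2 ≤ ∑ i, ‖(M *ᵥ Pi.single j 1) i‖ ^ 2 := by
    have := Finset.single_le_sum (f := fun i => ‖(M *ᵥ Pi.single j 1) i‖ ^ 2)
      (fun i _ => by positivity) (Finset.mem_univ i)
    simpa using this
  have h2 : ∑ k, ‖(Pi.single j 1 : Fin q → ℂ) k‖ ^ 2 = 1 := by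
    rw [Finset.sum_eq_single j] <;> simp +contextual
  rw [h2] at h
  exact (sq_le_one_iff₀ (norm_nonneg _)).1 (h1.trans h)

theorem NetworkModel.sum_norm_sq_localTransfer_le {N n m : ℕ} (net : NetworkModel N n m)
    {i : Fin N} (h : net.peakGain i ≤ 1) (ω : ℝ)
    (hu : IsUnit (net.localPencil i (ω * Complex.I))) (v : Fin m → ℂ) :
    ∑ k, ‖(net.localTransfer i (ω * Complex.I) *ᵥ v) k‖ ^ 2 ≤ ∑ k, ‖v k‖ ^ 2 := by
  refine sum_norm_sq_mulVec_le_of_sigmaMax_le_one ?_ v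
  have := (le_iSup₂ (f := fun (ω : ℝ) (_ : IsUnit (net.localPencil i (ω * Complex.I))) =>
    ENNReal.ofReal (sigmaMax (net.localTransfer i (ω * Complex.I)))) ω hu).trans h
  simpa using this

/-! ### Output feedback and eigenvalues on the imaginary axis. -/

/-- Sylvester's determinant identity turns singularity of the closed-loop pencil into a condition on
the transfer matrix `C P⁻¹ B`. -/
theorem Matrix.det_add_smul_mul_eq {n m : ℕ} {P : Matrix (Fin n) (Fin n) ℂ} (hP : IsUnit P)
    (B : Matrix (Fin n) (Fin m) ℂ) (C : Matrix (Fin m) (Fin n) ℂ) (c : ℂ) :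
    (P + c • (B * C)).det = P.det * (1 + c • (C * P⁻¹ * B)).det := by
  have hd : IsUnit P.det := (Matrix.isUnit_iff_isUnit_det P).1 hP
  have h1 : P + c • (B * C) = P * (1 + (c • (P⁻¹ * B)) * C) := by
    rw [mul_add, mul_one, Matrix.smul_mul, Matrix.mul_smul, Matrix.mul_assoc,
      Matrix.mul_nonsing_inv_cancel_left _ _ hd]
  rw [h1, det_mul, det_one_add_mul_comm, Matrix.mul_smul, Matrix.mul_assoc]

theorem Matrix.finite_setOf_det_smul_one_sub_eq_zero {n : ℕ} (M : Matrix (Fin n) (Fin n) ℂ) :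
    {s : ℂ | (s • (1 : Matrix (Fin n) (Fin n) ℂ) - M).det = 0}.Finite := by
  have : {s : ℂ | (s • (1 : Matrix (Fin n) (Fin n) ℂ) - M).det = 0} = {s | M.charpoly.IsRoot s} := by
    ext s
    simp [Polynomial.IsRoot, Matrix.eval_charpoly, Matrix.smul_one_eq_diagonal, Matrix.scalar_apply]
  rw [this]
  exact Polynomial.finite_setOfPred_isRoot M.charpoly_monic.ne_zero

/-- If the scaled transfer matrix `k C (jωI - F)⁻¹ B` is contractive wherever it is defined and
some output feedback removes all eigenvalues of `F` from the imaginary axis, then no output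
feedback of size less than `|k|` has eigenvalues on the imaginary axis. -/
theorem Matrix.det_ne_zero_of_contractive {n m : ℕ} (F : Matrix (Fin n) (Fin n) ℂ)
    (B : Matrix (Fin n) (Fin m) ℂ) (C : Matrix (Fin m) (Fin n) ℂ) {k : ℂ} (hk : k ≠ 0)
    (hgain : ∀ ω : ℝ, IsUnit ((ω * Complex.I) • (1 : Matrix (Fin n) (Fin n) ℂ) - F) →
      ∀ v : Fin m → ℂ, ∑ i, ‖((k • (C * ((ω * Complex.I) • (1 : Matrix (Fin n) (Fin n) ℂ) - F)⁻¹
        * B)) *ᵥ v) i‖ ^ 2 ≤ ∑ j, ‖v j‖ ^ 2)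
    {c₀ : ℂ} (h₀ : ∀ ω : ℝ,
      ((ω * Complex.I) • (1 : Matrix (Fin n) (Fin n) ℂ) - F + c₀ • (B * C)).det ≠ 0)
    {c : ℂ} (hc : ‖c‖ < ‖k‖) (ω : ℝ) :
    ((ω * Complex.I) • (1 : Matrix (Fin n) (Fin n) ℂ) - F + c • (B * C)).det ≠ 0 := by
  set P : ℝ → Matrix (Fin n) (Fin n) ℂ := fun ω => (ω * Complex.I) • 1 - F with hPdef
  have hPc : Continuous P := by fun_prop
  have hev : ∀ᶠ w in 𝓝[≠] ω, IsUnit (P w) := by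
    have hf : {w : ℝ | (P w).det = 0}.Finite :=
      F.finite_setOf_det_smul_one_sub_eq_zero.preimage
        (f := fun w : ℝ => (w * Complex.I : ℂ)) (by
          intro a _ b _ hab
          simpa using hab)
    have h1 : ∀ᶠ w in 𝓝[≠] ω, w ∉ {w : ℝ | (P w).det = 0} \ {ω} := by
      apply mem_nhdsWithin_of_mem_nhds
      exact (hf.sdiff).isClosed.isOpen_compl.mem_nhds (by simp)
    filter_upwards [h1, self_mem_nhdsWithin] with w h1 h2
    rw [Matrix.isUnit_iff_isUnit_det, isUnit_iff_ne_zero]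
    exact fun h => h1 ⟨h, h2⟩
  -- Contractivity says nothing at `ω` itself if `P ω` is singular. Near `ω`, `det (P + c₀ BC)` is
  -- `det P` times a bounded factor; a zero of `det P` at `ω` would thus be one of `det (P + c₀
  -- BC)`, against `h₀`. Hence no axis eigenvalue is hidden from the transfer matrix.
  have hu : IsUnit (P ω) := by
    by_contra hcon
    have hdet : (P ω).det = 0 := by
      rwa [Matrix.isUnit_iff_isUnit_det, isUnit_iff_ne_zero, not_not] at hcon
    obtain ⟨K, hK⟩ : ∃ K : ℝ, ∀ w, IsUnit (P w) → ‖(1 + c₀ • (C * (P w)⁻¹ * B)).det‖ ≤ K := by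
      refine ⟨_, fun w hw => Matrix.det_le (abv := NormedField.toAbsoluteValue ℂ)
        (x := 1 + ‖c₀ / k‖) fun i j => ?_⟩
      have h1 : c₀ • (C * (P w)⁻¹ * B) = (c₀ / k) • (k • (C * (P w)⁻¹ * B)) := by
        rw [smul_smul, div_mul_cancel₀ _ hk]
      have h2 := norm_apply_le_one_of_sum_norm_sq_mulVec_le (hgain w hw) i j
      rw [h1]
      change ‖(1 : Matrix (Fin m) (Fin m) ℂ) i j + (c₀ / k) * (k • (C * (P w)⁻¹ * B)) i j‖ ≤ _
      refine (norm_add_le _ _).trans (add_le_add ?_ ?_)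
      · rw [Matrix.one_apply]; split_ifs <;> simp
      · rw [norm_mul]
        exact mul_le_of_le_one_right (norm_nonneg _) h2
    have ht1 : Tendsto (fun w => ‖(P w + c₀ • (B * C)).det‖) (𝓝[≠] ω)
        (𝓝 ‖(P ω + c₀ • (B * C)).det‖) := by
      have : Continuous fun w => ‖(P w + c₀ • (B * C)).det‖ := by fun_prop
      exact (this.tendsto ω).mono_left nhdsWithin_le_nhds
    have ht2 : Tendsto (fun w => ‖(P w).det‖ * K) (𝓝[≠] ω) (𝓝 (‖(P ω).det‖ * K)) := by
      have : Continuous fun w => ‖(P w).det‖ * K := by fun_prop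
      exact (this.tendsto ω).mono_left nhdsWithin_le_nhds
    have hle := le_of_tendsto_of_tendsto ht1 ht2 (by
      filter_upwards [hev] with w hw
      rw [Matrix.det_add_smul_mul_eq hw, norm_mul]
      exact mul_le_mul_of_nonneg_left (hK w hw) (norm_nonneg _))
    rw [hdet, norm_zero, zero_mul] at hle
    exact h₀ ω (norm_le_zero_iff.1 hle)
  change (P ω + c • (B * C)).det ≠ 0
  rw [Matrix.det_add_smul_mul_eq hu]
  refine mul_ne_zero ((isUnit_iff_ne_zero).1 ((Matrix.isUnit_iff_isUnit_det _).1 hu)) fun h => ?_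
  -- A kernel vector satisfies `v = -(c/k) H v` with `H` contractive and `‖c/k‖ < 1`, which is
  -- impossible for `v ≠ 0`.
  obtain ⟨v, hv0, hv⟩ := Matrix.exists_mulVec_eq_zero_iff.2 h
  have hg := hgain ω hu v
  change ∑ i, ‖((k • (C * (P ω)⁻¹ * B)) *ᵥ v) i‖ ^ 2 ≤ ∑ j, ‖v j‖ ^ 2 at hg
  have hvH : ∀ i, ‖v i‖ ^ 2 = (‖c‖ / ‖k‖) ^ 2 * ‖((k • (C * (P ω)⁻¹ * B)) *ᵥ v) i‖ ^ 2 := by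
    intro i
    have h1 : v i = -(c * ((C * (P ω)⁻¹ * B) *ᵥ v) i) := by
      have := congrFun hv i
      rw [Matrix.add_mulVec, Matrix.one_mulVec, Matrix.smul_mulVec] at this
      simpa using eq_neg_of_add_eq_zero_left this
    rw [Matrix.smul_mulVec, Pi.smul_apply, smul_eq_mul, h1, norm_neg, norm_mul, norm_mul]
    have : ‖k‖ ≠ 0 := norm_ne_zero_iff.2 hk
    field_simp
  have hpos : 0 < ∑ j, ‖v j‖ ^ 2 := by
    obtain ⟨j, hj⟩ := Function.ne_iff.1 hv0
    exact Finset.sum_pos' (fun _ _ => by positivity)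
      ⟨j, Finset.mem_univ j, by have := norm_pos_iff.2 hj; positivity⟩
  have hsum : ∑ j, ‖v j‖ ^ 2 =
      (‖c‖ / ‖k‖) ^ 2 * ∑ i, ‖((k • (C * (P ω)⁻¹ * B)) *ᵥ v) i‖ ^ 2 := by
    rw [Finset.mul_sum]
    exact Finset.sum_congr rfl fun i _ => hvH i
  have hlt : (‖c‖ / ‖k‖) ^ 2 < 1 := by
    rw [sq_lt_one_iff₀ (by positivity), div_lt_one (norm_pos_iff.2 hk)]
    exact hc
  have := mul_le_mul_of_nonneg_left hg (sq_nonneg (‖c‖ / ‖k‖))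
  nlinarith

/-! ### Hurwitz matrices and continuity of eigenvalues. -/

/-- A square complex matrix all of whose eigenvalues have negative real part. -/
def Matrix.IsHurwitz {n : ℕ} (M : Matrix (Fin n) (Fin n) ℂ) : Prop :=
  ∀ s : ℂ, 0 ≤ s.re → (s • (1 : Matrix (Fin n) (Fin n) ℂ) - M).det ≠ 0

theorem Matrix.eval_charpoly_eq_det_smul_one_sub {n : ℕ} (M : Matrix (Fin n) (Fin n) ℂ) (s : ℂ) :
    M.charpoly.eval s = (s • (1 : Matrix (Fin n) (Fin n) ℂ) - M).det := by
  simp [Matrix.eval_charpoly, Matrix.smul_one_eq_diagonal, Matrix.scalar_apply]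

theorem Matrix.det_smul_one_sub_eq_zero_iff_exists_mulVec {n : ℕ} (M : Matrix (Fin n) (Fin n) ℂ)
    (s : ℂ) : (s • (1 : Matrix (Fin n) (Fin n) ℂ) - M).det = 0 ↔
      ∃ v, v ≠ 0 ∧ M *ᵥ v = s • v := by
  rw [← Matrix.exists_mulVec_eq_zero_iff]
  simp only [Matrix.sub_mulVec, Matrix.smul_mulVec, Matrix.one_mulVec, sub_eq_zero, eq_comm]

theorem Matrix.norm_le_of_det_smul_one_sub_eq_zero {n : ℕ} {M : Matrix (Fin n) (Fin n) ℂ} {s : ℂ}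
    (h : (s • (1 : Matrix (Fin n) (Fin n) ℂ) - M).det = 0) : ‖s‖ ≤ ∑ i, ∑ j, ‖M i j‖ := by
  obtain ⟨v, hv0, hv⟩ := (M.det_smul_one_sub_eq_zero_iff_exists_mulVec s).1 h
  have hvp : 0 < ‖v‖ := norm_pos_iff.2 hv0
  have h1 : ‖s • v‖ ≤ (∑ i, ∑ j, ‖M i j‖) * ‖v‖ := by
    rw [← hv, pi_norm_le_iff_of_nonneg (by positivity)]
    intro i
    calc ‖(M *ᵥ v) i‖ ≤ ∑ j, ‖M i j * v j‖ := by
          simp only [Matrix.mulVec, dotProduct]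
          exact norm_sum_le _ _
      _ ≤ ∑ j, ‖M i j‖ * ‖v‖ := by
        refine Finset.sum_le_sum fun j _ => ?_
        rw [norm_mul]
        gcongr
        exact norm_le_pi_norm v j
      _ = (∑ j, ‖M i j‖) * ‖v‖ := by rw [Finset.sum_mul]
      _ ≤ _ := mul_le_mul_of_nonneg_right
        (Finset.single_le_sum (f := fun i => ∑ j, ‖M i j‖)
          (fun i _ => by positivity) (Finset.mem_univ i)) hvp.le
  rw [norm_smul] at h1
  exact le_of_mul_le_mul_right h1 hvp

/-- A monic complex polynomial whose roots all stay at distance at least `r` from `z` is at least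
`r ^ natDegree` in modulus at `z`. -/
theorem Polynomial.Monic.pow_natDegree_le_norm_eval {p : Polynomial ℂ} (hp : p.Monic) {z : ℂ}
    {r : ℝ} (hr : 0 ≤ r) (h : ∀ x, p.IsRoot x → r ≤ ‖z - x‖) :
    r ^ p.natDegree ≤ ‖p.eval z‖ := by
  have hs := IsAlgClosed.splits p
  rw [hs.eval_eq_prod_roots_of_monic hp, hs.natDegree_eq_card_roots]
  have hroots : ∀ x ∈ p.roots, r ≤ ‖z - x‖ := fun x hx => h x (Polynomial.isRoot_of_mem_roots hx)
  generalize p.roots = S at hroots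
  induction S using Multiset.induction with
  | empty => simp
  | cons a S ih =>
    rw [Multiset.card_cons, Multiset.map_cons, Multiset.prod_cons, norm_mul, pow_succ, mul_comm]
    exact mul_le_mul (hroots a (Multiset.mem_cons_self a S))
      (ih fun x hx => hroots x (Multiset.mem_cons_of_mem hx)) (by positivity) (norm_nonneg _)

/-- The parameters with an unstable eigenvalue form a clopen subset of the connected interval,
because eigenvalues vary continuously and cannot cross the axis. -/
theorem Matrix.isHurwitz_of_path {n : ℕ} {M : unitInterval → Matrix (Fin n) (Fin n) ℂ}
    (hM : Continuous M)
    (haxis : ∀ t, ∀ ω : ℝ, ((ω * Complex.I) • (1 : Matrix (Fin n) (Fin n) ℂ) - M t).det ≠ 0)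
    (h0 : (M 0).IsHurwitz) : (M 1).IsHurwitz := by
  have hdc : Continuous fun p : unitInterval × ℂ =>
      (p.2 • (1 : Matrix (Fin n) (Fin n) ℂ) - M p.1).det := by fun_prop
  have hpos : ∀ t, ¬ (M t).IsHurwitz →
      ∃ s : ℂ, 0 < s.re ∧ (s • (1 : Matrix (Fin n) (Fin n) ℂ) - M t).det = 0 := by
    intro t ht
    simp only [Matrix.IsHurwitz, not_forall, not_not] at ht
    obtain ⟨s, hs, hd⟩ := ht
    refine ⟨s, hs.lt_of_ne fun h => ?_, hd⟩
    refine haxis t s.im ?_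
    have : (s.im * Complex.I : ℂ) = s := by
      apply Complex.ext <;> simp [← h]
    rwa [this]
  have hclosed : IsClosed {t | ¬ (M t).IsHurwitz} := by
    obtain ⟨R, hR⟩ : ∃ R : ℝ, ∀ t, ∑ i, ∑ j, ‖M t i j‖ ≤ R := by
      have hc : Continuous fun t => ∑ i, ∑ j, ‖M t i j‖ := by fun_prop
      obtain ⟨R, hR⟩ := (isCompact_range hc).bddAbove
      exact ⟨R, fun t => hR ⟨t, rfl⟩⟩
    -- The eigenvalues are uniformly bounded along the path, so the bad set is the projection of a
    -- compact set of pairs (parameter, eigenvalue).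
    have hS : {t | ¬ (M t).IsHurwitz} = Prod.fst '' ({p : unitInterval × ℂ |
        (p.2 • (1 : Matrix (Fin n) (Fin n) ℂ) - M p.1).det = 0 ∧ 0 ≤ p.2.re} ∩
          (univ ×ˢ Metric.closedBall 0 R)) := by
      ext t
      constructor
      · intro ht
        obtain ⟨s, hs, hd⟩ := hpos t ht
        exact ⟨(t, s), ⟨⟨hd, hs.le⟩, mem_univ _, by
          simpa using (Matrix.norm_le_of_det_smul_one_sub_eq_zero hd).trans (hR t)⟩, rfl⟩
      · rintro ⟨⟨t', s⟩, ⟨⟨hd, hs⟩, -⟩, rfl⟩ h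
        exact h s hs hd
    rw [hS]
    refine IsCompact.isClosed (IsCompact.image ?_ continuous_fst)
    refine (isCompact_univ.prod (isCompact_closedBall 0 R)).inter_left ?_
    exact (isClosed_eq hdc continuous_const).inter
      (isClosed_le continuous_const (Complex.continuous_re.comp continuous_snd))
  have hopen : IsOpen {t | ¬ (M t).IsHurwitz} := by
    rw [isOpen_iff_mem_nhds]
    intro t ht
    obtain ⟨s, hs, hd⟩ := hpos t ht
    have hc : Continuous fun t' => ‖(s • (1 : Matrix (Fin n) (Fin n) ℂ) - M t').det‖ := by
      fun_prop
    -- If `M t'` were Hurwitz, all its eigenvalues would be at distance at least `s.re` from `s`,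
    -- and its characteristic polynomial at `s` would have modulus at least `s.re ^ n`.
    have hlt : ∀ᶠ t' in 𝓝 t, ‖(s • (1 : Matrix (Fin n) (Fin n) ℂ) - M t').det‖ < s.re ^ n := by
      refine hc.continuousAt.eventually_lt_const ?_
      simp only [hd, norm_zero]
      positivity
    filter_upwards [hlt] with t' ht' hH
    rw [← Matrix.eval_charpoly_eq_det_smul_one_sub] at ht'
    refine ht'.not_ge ?_
    have h := (M t').charpoly_monic.pow_natDegree_le_norm_eval (z := s) hs.le fun x hx => ?_
    · simpa [Matrix.charpoly_natDegree_eq_dim] using h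
    · have hx' : (x • (1 : Matrix (Fin n) (Fin n) ℂ) - M t').det = 0 := by
        rw [← Matrix.eval_charpoly_eq_det_smul_one_sub]; exact hx
      have hxre : x.re < 0 := by
        by_contra hcon
        exact hH x (not_lt.1 hcon) hx'
      calc s.re ≤ (s - x).re := by simp [hxre.le]
        _ ≤ ‖s - x‖ := Complex.re_le_norm _
  by_contra h1
  have huniv := IsClopen.eq_univ ⟨hclosed, hopen⟩ ⟨1, h1⟩
  have : (0 : unitInterval) ∈ {t | ¬ (M t).IsHurwitz} := huniv ▸ mem_univ _
  exact this h0

/-! ### Fourier series: energy gain on periodic signals. -/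

theorem fourierCoeffOn_sum_mul {ι : Type*} (s : Finset ι) {a b : ℝ} (hab : a < b) (c : ι → ℂ)
    {φ : ι → ℝ → ℂ} (hφ : ∀ i ∈ s, IntervalIntegrable (φ i) volume a b) (n : ℤ) :
    fourierCoeffOn hab (fun t => ∑ i ∈ s, c i * φ i t) n =
      ∑ i ∈ s, c i * fourierCoeffOn hab (φ i) n := by
  simp only [fourierCoeffOn_eq_integral, smul_eq_mul, Finset.mul_sum]
  rw [intervalIntegral.integral_finsetSum]
  · rw [Finset.smul_sum]
    refine Finset.sum_congr rfl fun i _ => ?_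
    simp only [mul_left_comm _ (c i)]
    rw [intervalIntegral.integral_const_mul, mul_smul_comm]
  · intro i hi
    refine IntervalIntegrable.continuousOn_mul ((hφ i hi).const_mul (c i)) ?_
    exact ((map_continuous (fourier (-n))).comp (AddCircle.continuous_mk' (b - a))).continuousOn

/-- A transfer matrix that is contractive on the imaginary axis does not increase the energy of
periodic signals. -/
theorem integral_sum_norm_sq_le_of_periodic {n m p : ℕ} {A : Matrix (Fin n) (Fin n) ℂ}
    {B : Matrix (Fin n) (Fin m) ℂ} {C : Matrix (Fin p) (Fin n) ℂ}
    (hA : ∀ ω : ℝ, IsUnit ((ω * Complex.I) • (1 : Matrix (Fin n) (Fin n) ℂ) - A))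
    (hgain : ∀ ω : ℝ, ∀ v : Fin m → ℂ,
      ∑ i, ‖((C * ((ω * Complex.I) • (1 : Matrix (Fin n) (Fin n) ℂ) - A)⁻¹ * B) *ᵥ v) i‖ ^ 2
        ≤ ∑ j, ‖v j‖ ^ 2)
    {R : ℝ} (hR : 0 < R) {f : ℝ → Fin n → ℂ} {g : ℝ → Fin m → ℂ} (hf : Continuous f)
    (hg : ∀ l, MemLp (fun t => g t l) 2 (volume.restrict (Ioc 0 R)))
    (hfg : ∀ t ∈ Ioo 0 R, HasDerivWithinAt f (A *ᵥ f t + B *ᵥ g t) (Ioi t) t)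
    (hper : f R = f 0) :
    ∫ t in (0 : ℝ)..R, ∑ k, ‖(C *ᵥ f t) k‖ ^ 2 ≤ ∫ t in (0 : ℝ)..R, ∑ l, ‖g t l‖ ^ 2 := by
  have hgi : ∀ l, IntervalIntegrable (fun t => g t l) volume 0 R := fun l => by
    rw [intervalIntegrable_iff_integrableOn_Ioc_of_le hR.le]
    exact (hg l).integrable one_le_two
  have hfi : ∀ k, IntervalIntegrable (fun t => f t k) volume 0 R := fun k =>
    ((continuous_apply k).comp hf).intervalIntegrable 0 R
  set c : ℤ → Fin n → ℂ := fun q k => fourierCoeffOn hR (fun t => f t k) q with hc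
  set d : ℤ → Fin m → ℂ := fun q l => fourierCoeffOn hR (fun t => g t l) q with hd
  have hCc : ∀ q k, fourierCoeffOn hR (fun t => (C *ᵥ f t) k) q = (C *ᵥ c q) k := fun q k =>
    fourierCoeffOn_sum_mul _ hR _ (fun i _ => hfi i) q
  have hder : ∀ q k, fourierCoeffOn hR (fun t => (A *ᵥ f t + B *ᵥ g t) k) q
      = (A *ᵥ c q + B *ᵥ d q) k := by
    intro q k
    have h := fourierCoeffOn_sum_mul Finset.univ hR
      (Sum.elim (A k) (B k)) (φ := Sum.elim (fun i t => f t i) (fun l t => g t l))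
      (by rintro (i | l) -; exacts [hfi i, hgi l]) q
    simpa [Fintype.sum_sum_type, Matrix.mulVec, dotProduct] using h
  have hfk : ∀ k, ∀ t ∈ Ioo (0 : ℝ) R,
      HasDerivWithinAt (fun t => f t k) ((A *ᵥ f t + B *ᵥ g t) k) (Ioi t) t := fun k t ht =>
    (hasDerivWithinAt_pi.1 (hfg t ht)) k
  have hint : ∀ k, IntervalIntegrable (fun t => (A *ᵥ f t + B *ᵥ g t) k) volume 0 R := by
    intro k
    simp only [Pi.add_apply, Matrix.mulVec, dotProduct]
    have := (IntervalIntegrable.sum Finset.univ fun i _ => (hfi i).const_mul (A k i)).add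
      (IntervalIntegrable.sum Finset.univ fun i _ => (hgi i).const_mul (B k i))
    simpa only [Finset.sum_apply] using this
  -- Periodicity removes the boundary term, so differentiation multiplies the `q`-th coefficient by
  -- `jω` with `ω = 2πq/R`. The case `q = 0` is separate because the coefficient formula for
  -- derivatives divides by `q`.
  have heq : ∀ q : ℤ, ((((2 * Real.pi * q / R : ℝ) : ℂ) * Complex.I) • c q) =
      A *ᵥ c q + B *ᵥ d q := by
    intro q
    ext k
    rw [← hder]
    have hRc : (R : ℂ) ≠ 0 := by exact_mod_cast hR.ne'
    rcases eq_or_ne q 0 with rfl | hq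
    · have h1 := intervalIntegral.integral_eq_sub_of_hasDeriv_right_of_le hR.le
        ((continuous_apply k).comp hf).continuousOn (hfk k) (hint k)
      simp only [Function.comp_apply, hper, sub_self] at h1
      simp [fourierCoeffOn_eq_integral]
      right; exact h1
    · have h1 := fourierCoeffOn_of_hasDeriv_right hR hq
        ((continuous_apply k).comp hf).continuousOn
        (by rw [min_eq_left hR.le, max_eq_right hR.le]; exact hfk k) (hint k)
      have h2 : c q k = _ := h1
      simp only [Function.comp_apply, hper, sub_self] at h2
      have hqc : (q : ℂ) ≠ 0 := by exact_mod_cast hq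
      have hpi : (Real.pi : ℂ) ≠ 0 := by exact_mod_cast Real.pi_ne_zero
      rw [Pi.smul_apply, h2, smul_eq_mul]
      push_cast
      field_simp
      ring
  -- Each output coefficient is the transfer matrix at `jω` applied to the input coefficient;
  -- Parseval then sums these inequalities.
  have hle : ∀ q : ℤ, ∑ k, ‖(C *ᵥ c q) k‖ ^ 2 ≤ ∑ l, ‖d q l‖ ^ 2 := by
    intro q
    refine le_trans (le_of_eq ?_) (hgain (2 * Real.pi * q / R) (d q))
    set P := (((2 * Real.pi * q / R : ℝ) : ℂ) * Complex.I) • (1 : Matrix (Fin n) (Fin n) ℂ) - A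
      with hP
    have h1 : P *ᵥ c q = B *ᵥ d q := by
      rw [hP, Matrix.sub_mulVec, Matrix.smul_mulVec, Matrix.one_mulVec, heq, add_sub_cancel_left]
    have h2 : c q = P⁻¹ *ᵥ (B *ᵥ d q) := by
      rw [← h1, Matrix.mulVec_mulVec,
        Matrix.nonsing_inv_mul _ ((Matrix.isUnit_iff_isUnit_det _).1 (hA _)), Matrix.one_mulVec]
    have h3 : C *ᵥ c q = (C * P⁻¹ * B) *ᵥ d q := by
      rw [← Matrix.mulVec_mulVec, ← Matrix.mulVec_mulVec, ← h2]
    rw [h3]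
  have hCf : Continuous fun t => C *ᵥ f t := by fun_prop
  have hs1 : ∀ k, HasSum (fun q => ‖(C *ᵥ c q) k‖ ^ 2)
      (R⁻¹ * ∫ t in (0 : ℝ)..R, ‖(C *ᵥ f t) k‖ ^ 2) := by
    intro k
    have hck : Continuous fun t => (C *ᵥ f t) k := (continuous_apply k).comp hCf
    have hm : MemLp (fun t => (C *ᵥ f t) k) 2 (volume.restrict (Ioc 0 R)) := by
      rw [memLp_two_iff_integrable_sq_norm hck.aestronglyMeasurable]
      have : Continuous fun t => ‖(C *ᵥ f t) k‖ ^ 2 := by fun_prop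
      exact (this.intervalIntegrable 0 R).1
    have := hasSum_sq_fourierCoeffOn hR hm
    simpa only [hCc, sub_zero, smul_eq_mul] using this
  have hs2 : ∀ l, HasSum (fun q => ‖d q l‖ ^ 2)
      (R⁻¹ * ∫ t in (0 : ℝ)..R, ‖g t l‖ ^ 2) := by
    intro l
    simpa only [sub_zero, smul_eq_mul] using hasSum_sq_fourierCoeffOn hR (hg l)
  have hfin := hasSum_le hle (hasSum_sum fun k (_ : k ∈ Finset.univ) => hs1 k)
    (hasSum_sum fun l (_ : l ∈ Finset.univ) => hs2 l)
  rw [← Finset.mul_sum, ← Finset.mul_sum] at hfin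
  rw [intervalIntegral.integral_finsetSum, intervalIntegral.integral_finsetSum]
  · exact le_of_mul_le_mul_left hfin (inv_pos.2 hR)
  · intro l _
    rw [intervalIntegrable_iff_integrableOn_Ioc_of_le hR.le]
    exact (memLp_two_iff_integrable_sq_norm (hg l).1).1 (hg l)
  · intro k _
    have : Continuous fun t => ‖(C *ᵥ f t) k‖ ^ 2 :=
      ((continuous_apply k).comp hCf).norm.pow 2
    exact this.intervalIntegrable 0 R

/-! ### Decay of the exponential of a Hurwitz matrix. -/

/-- On a generalized eigenvector the series of `exp (t (F - μ))` terminates, leaving `exp (tμ)`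
times a polynomial in `t`. -/
theorem ContinuousLinearMap.tendsto_exp_smul_apply_of_sub_smul_pow_apply_eq_zero
    {V : Type*} [NormedAddCommGroup V] [NormedSpace ℂ V] [CompleteSpace V] (F : V →L[ℂ] V)
    {μ : ℂ} (hμ : μ.re < 0) {k : ℕ} {v : V} (hv : ((F - μ • 1) ^ k) v = 0) :
    Tendsto (fun t : ℝ => NormedSpace.exp ((t : ℂ) • F) v) atTop (𝓝 0) := by
  let _ := NormedAlgebra.restrictScalars ℚ ℂ (V →L[ℂ] V)
  have key : ∀ t : ℝ, NormedSpace.exp ((t : ℂ) • F) v =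
      ∑ j ∈ Finset.range k, (Complex.exp (t * μ) * ((j.factorial : ℂ)⁻¹ * t ^ j)) •
        ((F - μ • 1) ^ j) v := by
    intro t
    have h1 : (t : ℂ) • F = algebraMap ℂ (V →L[ℂ] V) (t * μ) + (t : ℂ) • (F - μ • 1) := by
      rw [Algebra.algebraMap_eq_smul_one, smul_sub, smul_smul, add_sub_cancel]
    rw [h1, NormedSpace.exp_add_of_commute (Algebra.commutes _ _),
      ← NormedSpace.algebraMap_exp_comm, ← Complex.exp_eq_exp_ℂ, Algebra.algebraMap_eq_smul_one,
      smul_mul_assoc, one_mul, _root_.smul_apply]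
    have h2 := (NormedSpace.exp_series_hasSum_exp' (𝕂 := ℂ) ((t : ℂ) • (F - μ • 1))).mapL
      (ContinuousLinearMap.apply ℂ V v)
    have h3 := h2.unique (hasSum_sum_of_ne_finset_zero (s := Finset.range k) fun j hj => by
      rw [Finset.mem_range, not_lt] at hj
      obtain ⟨i, rfl⟩ := Nat.exists_eq_add_of_le' hj
      rw [ContinuousLinearMap.apply_apply, smul_pow, pow_add (F - μ • 1), _root_.smul_apply,
        _root_.smul_apply, mul_apply_eq_comp, hv, map_zero, smul_zero, smul_zero])
    simp only [ContinuousLinearMap.apply_apply] at h3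
    rw [h3, Finset.smul_sum]
    refine Finset.sum_congr rfl fun j _ => ?_
    rw [smul_pow, _root_.smul_apply, _root_.smul_apply, smul_smul, smul_smul, mul_assoc]
  simp_rw [key]
  rw [← Finset.sum_const_zero (s := Finset.range k)]
  refine tendsto_finsetSum _ fun j _ => ?_
  rw [← zero_smul ℂ (((F - μ • 1) ^ j) v)]
  refine Tendsto.smul_const ?_ _
  rw [tendsto_zero_iff_norm_tendsto_zero]
  have h := (tendsto_rpow_mul_exp_neg_mul_atTop_nhds_zero j (-μ.re) (by linarith)).const_mul
    ((j.factorial : ℝ)⁻¹)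
  rw [mul_zero] at h
  refine h.congr' ?_
  filter_upwards [eventually_ge_atTop 0] with t ht
  simp [Complex.norm_exp, abs_of_nonneg ht]
  ring_nf

/-- Over `ℂ` the generalized eigenspaces span, and those with `0 ≤ μ.re` are trivial. -/
theorem Matrix.IsHurwitz.tendsto_exp_smul_apply {n : ℕ} {A : Matrix (Fin n) (Fin n) ℂ}
    (hA : A.IsHurwitz) (v : Fin n → ℂ) :
    Tendsto (fun t : ℝ => NormedSpace.exp ((t : ℂ) • (toLin' A).toContinuousLinearMap) v)
      atTop (𝓝 0) := by
  set F := (toLin' A).toContinuousLinearMap with hF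
  have hmem : v ∈ ⨆ μ, Module.End.maxGenEigenspace (toLin' A) μ := by
    rw [Module.End.iSup_maxGenEigenspace_eq_top]; trivial
  induction hmem using Submodule.iSup_induction' with
  | zero => simp
  | add x y _ _ hx hy => simpa using hx.add hy
  | mem μ x hx =>
    obtain ⟨k, hk⟩ := (Module.End.mem_maxGenEigenspace _ _ _).1 hx
    rcases lt_or_ge μ.re 0 with hμ | hμ
    · refine F.tendsto_exp_smul_apply_of_sub_smul_pow_apply_eq_zero hμ (k := k) ?_
      rw [← hk]
      have : ∀ (j : ℕ) (y : Fin n → ℂ), ((F - μ • (1 : (Fin n → ℂ) →L[ℂ] (Fin n → ℂ))) ^ j) y =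
          ((toLin' A - μ • (1 : Module.End ℂ (Fin n → ℂ))) ^ j) y := by
        intro j
        induction j with
        | zero => intro y; rfl
        | succ j ih =>
          intro y
          rw [pow_succ, pow_succ, mul_apply_eq_comp, Module.End.mul_apply, ih]
          rfl
      exact this k x
    · have : x = 0 := by
        induction k with
        | zero => simpa using hk
        | succ k ih =>
          apply ih
          rw [pow_succ'] at hk
          by_contra hne
          refine hA μ hμ ((A.det_smul_one_sub_eq_zero_iff_exists_mulVec μ).2 ⟨_, hne, ?_⟩)
          have h1 : (toLin' A - μ • 1) (((toLin' A - μ • 1) ^ k) x) = 0 := hk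
          simpa [sub_eq_zero] using h1
      simp [this]

theorem Matrix.IsHurwitz.tendsto_exp_smul {n : ℕ} {A : Matrix (Fin n) (Fin n) ℂ}
    (hA : A.IsHurwitz) :
    Tendsto (fun t : ℝ => NormedSpace.exp ((t : ℂ) • (toLin' A).toContinuousLinearMap))
      atTop (𝓝 0) := by
  have hbound : ∀ L : (Fin n → ℂ) →L[ℂ] (Fin n → ℂ), ‖L‖ ≤ ∑ i, ‖L (Pi.single i 1)‖ := by
    intro L
    refine L.opNorm_le_bound (by positivity) fun v => ?_
    have h1 : L v = ∑ i, v i • L (Pi.single i 1) := by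
      conv_lhs => rw [pi_eq_sum_univ' v]
      simp
    rw [h1, Finset.sum_mul]
    refine norm_sum_le_of_le _ fun i _ => ?_
    rw [norm_smul, mul_comm]
    gcongr
    exact norm_le_pi_norm v i
  refine squeeze_zero_norm (fun t => hbound _) ?_
  rw [← Finset.sum_const_zero (s := (Finset.univ : Finset (Fin n)))]
  refine tendsto_finsetSum _ fun i _ => ?_
  simpa using (hA.tendsto_exp_smul_apply (Pi.single i 1)).norm

/-! ### The bounded real lemma. -/

/-- **Bounded real lemma**, time-domain form: a stable linear system whose transfer matrix is
contractive on the imaginary axis does not increase the energy of a signal when started at rest. -/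
theorem Matrix.IsHurwitz.integral_sum_norm_sq_le {n m p : ℕ} {A : Matrix (Fin n) (Fin n) ℂ}
    {B : Matrix (Fin n) (Fin m) ℂ} {C : Matrix (Fin p) (Fin n) ℂ} (hA : A.IsHurwitz)
    (hgain : ∀ ω : ℝ, ∀ v : Fin m → ℂ,
      ∑ i, ‖((C * ((ω * Complex.I) • (1 : Matrix (Fin n) (Fin n) ℂ) - A)⁻¹ * B) *ᵥ v) i‖ ^ 2
        ≤ ∑ j, ‖v j‖ ^ 2)
    {T : ℝ} (hT : 0 < T) {x : ℝ → Fin n → ℂ} {u : ℝ → Fin m → ℂ} (hx : Continuous x)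
    (hu : Continuous u) (hxu : ∀ t ∈ Ioo 0 T, HasDerivAt x (A *ᵥ x t + B *ᵥ u t) t)
    (h0 : x 0 = 0) :
    ∫ t in (0 : ℝ)..T, ∑ k, ‖(C *ᵥ x t) k‖ ^ 2 ≤ ∫ t in (0 : ℝ)..T, ∑ l, ‖u t l‖ ^ 2 := by
  have hunit : ∀ ω : ℝ, IsUnit ((ω * Complex.I) • (1 : Matrix (Fin n) (Fin n) ℂ) - A) := by
    intro ω
    rw [Matrix.isUnit_iff_isUnit_det, isUnit_iff_ne_zero]
    exact hA _ (by simp)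
  set F := (toLin' A).toContinuousLinearMap with hF
  set Φ : ℝ → (Fin n → ℂ) →L[ℂ] (Fin n → ℂ) := fun t => NormedSpace.exp ((t : ℂ) • F) with hΦ
  have hΦ0 : Φ 0 = 1 := by
    have : ((0 : ℝ) : ℂ) • F = 0 := by rw [Complex.ofReal_zero]; exact zero_smul ℂ F
    change NormedSpace.exp (((0 : ℝ) : ℂ) • F) = 1
    rw [this]
    exact NormedSpace.exp_zero
  have hΦlim : Tendsto Φ atTop (𝓝 0) := hA.tendsto_exp_smul
  have hΦd' : ∀ t, HasDerivAt Φ (F * Φ t) t := fun t => by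
    have := (hasDerivAt_exp_smul_const' (𝕂 := ℂ) F (t : ℂ)).scomp t Complex.ofRealCLM.hasDerivAt
    refine HasDerivAt.congr_deriv (f := Φ) this ?_
    rw [Complex.ofRealCLM_apply, Complex.ofReal_one]
    exact one_smul ℂ _
  have hΦd : ∀ t v, HasDerivAt (fun t => Φ t v) (A *ᵥ Φ t v) t := by
    intro t v
    exact ((ContinuousLinearMap.apply ℂ (Fin n → ℂ) v).restrictScalars
      ℝ).hasFDerivAt.comp_hasDerivAt t (hΦd' t)
  have hΦc : Continuous Φ := by
    rw [continuous_iff_continuousAt]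
    exact fun t => (hΦd' t).continuousAt
  -- Start at `v` instead of `0`, apply `u` up to time `T`, then let the system run freely for time
  -- `S`. The hypothesis on `v` says that this motion returns to its start, so the periodic estimate
  -- applies.
  have hstep : ∀ S > 0, ∀ v, Φ S (x T + Φ T v) = v →
      ∫ t in (0 : ℝ)..T, ∑ k, ‖(C *ᵥ (x t + Φ t v)) k‖ ^ 2 ≤
        ∫ t in (0 : ℝ)..T, ∑ l, ‖u t l‖ ^ 2 := by
    intro S hS v hv
    -- One formula for both phases: it reads `x t + Φ t v` for `t ≤ T` and the free motion for `t ≥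
    -- T`. At `T` the input jumps, which is why only right derivatives are required.
    set f : ℝ → Fin n → ℂ := fun t => Φ (max (t - T) 0) (x (min t T) + Φ (min t T) v) with hf
    set g : ℝ → Fin m → ℂ := fun t => if t < T then u t else 0 with hg
    have hR : 0 < T + S := by linarith
    have hfc : Continuous f := by fun_prop
    have hgm : ∀ l, MemLp (fun t => g t l) 2 (volume.restrict (Ioc 0 (T + S))) := by
      intro l
      have hul : Continuous fun t => u t l := (continuous_apply l).comp hu
      have h1 : MemLp (fun t => u t l) 2 (volume.restrict (Ioc 0 (T + S))) := by
        rw [memLp_two_iff_integrable_sq_norm hul.aestronglyMeasurable]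
        exact ((hul.norm.pow 2).intervalIntegrable 0 (T + S)).1
      have h2 : (fun t => g t l) = (Iio T).indicator fun t => u t l := by
        ext t
        by_cases ht : t < T <;> simp [hg, ht]
      rw [h2]
      exact h1.indicator measurableSet_Iio
    have hfg : ∀ t ∈ Ioo 0 (T + S), HasDerivWithinAt f (A *ᵥ f t + B *ᵥ g t) (Ioi t) t := by
      intro t ht
      rcases lt_or_ge t T with htT | htT
      · have heq : ∀ s < T, f s = x s + Φ s v := by
          intro s hs
          simp [hf, max_eq_right (sub_nonpos.2 hs.le), min_eq_left hs.le, hΦ0]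
        have h1 := (hxu t ⟨ht.1, htT⟩).add (hΦd t v)
        have h2 : HasDerivAt f (A *ᵥ f t + B *ᵥ g t) t := by
          refine (h1.congr_of_eventuallyEq ?_).congr_deriv ?_
          · filter_upwards [Iio_mem_nhds htT] with s hs using heq s hs
          · rw [heq t htT, Matrix.mulVec_add]
            simp only [hg, htT, if_true]
            abel
        exact h2.hasDerivWithinAt
      · have heq : ∀ s ≥ T, f s = Φ (s - T) (x T + Φ T v) := by
          intro s hs
          simp [hf, max_eq_left (sub_nonneg.2 hs), min_eq_right hs]
        have h1 := (hΦd (t - T) (x T + Φ T v)).comp_sub_const t T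
        rw [heq t htT]
        simp only [hg, htT.not_gt, if_false, Matrix.mulVec_zero, add_zero]
        exact h1.hasDerivWithinAt.congr (fun s hs => heq s (htT.trans (le_of_lt hs)))
          (heq t htT)
    have hper : f (T + S) = f 0 := by
      simp [hf, hS.le, hT.le, h0, hΦ0]
      simpa using hv
    have hmain := integral_sum_norm_sq_le_of_periodic (C := C) hunit hgain hR hfc hgm hfg hper
    have hfcont : Continuous fun t => ∑ k, ‖(C *ᵥ f t) k‖ ^ 2 := by
      have : Continuous fun t => C *ᵥ f t := by fun_prop
      fun_prop
    have hgint : IntervalIntegrable (fun t => ∑ l, ‖g t l‖ ^ 2) volume 0 (T + S) := by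
      rw [intervalIntegrable_iff_integrableOn_Ioc_of_le hR.le]
      exact integrable_finsetSum _ fun l _ =>
        (memLp_two_iff_integrable_sq_norm (hgm l).1).1 (hgm l)
    have hsub1 : uIcc 0 T ⊆ uIcc 0 (T + S) := by
      rw [uIcc_of_le hT.le, uIcc_of_le hR.le]; exact Icc_subset_Icc_right (by linarith)
    have hsub2 : uIcc T (T + S) ⊆ uIcc 0 (T + S) := by
      rw [uIcc_of_le (by linarith), uIcc_of_le hR.le]; exact Icc_subset_Icc_left hT.le
    have hucont : Continuous fun t => ∑ l, ‖u t l‖ ^ 2 := by fun_prop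
    calc ∫ t in (0 : ℝ)..T, ∑ k, ‖(C *ᵥ (x t + Φ t v)) k‖ ^ 2
        = ∫ t in (0 : ℝ)..T, ∑ k, ‖(C *ᵥ f t) k‖ ^ 2 := by
          refine intervalIntegral.integral_congr fun t ht => ?_
          rw [uIcc_of_le hT.le] at ht
          simp [hf, max_eq_right (sub_nonpos.2 ht.2), min_eq_left ht.2, hΦ0]
      _ ≤ ∫ t in (0 : ℝ)..(T + S), ∑ k, ‖(C *ᵥ f t) k‖ ^ 2 := by
          refine intervalIntegral.integral_mono_interval le_rfl hT.le (by linarith) ?_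
            (hfcont.intervalIntegrable _ _)
          exact Eventually.of_forall fun t => Finset.sum_nonneg fun _ _ => by positivity
      _ ≤ ∫ t in (0 : ℝ)..(T + S), ∑ l, ‖g t l‖ ^ 2 := hmain
      _ = (∫ t in (0 : ℝ)..T, ∑ l, ‖g t l‖ ^ 2) + ∫ t in T..(T + S), ∑ l, ‖g t l‖ ^ 2 :=
          (intervalIntegral.integral_add_adjacent_intervals (hgint.mono_set hsub1)
            (hgint.mono_set hsub2)).symm
      _ = ∫ t in (0 : ℝ)..T, ∑ l, ‖g t l‖ ^ 2 := by
          rw [add_eq_left, intervalIntegral.integral_congr (g := fun _ => (0 : ℝ)),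
            intervalIntegral.integral_zero]
          intro t ht
          rw [uIcc_of_le (by linarith)] at ht
          simp [hg, ht.1.not_gt]
      _ ≤ ∫ t in (0 : ℝ)..T, ∑ l, ‖u t l‖ ^ 2 := by
          refine intervalIntegral.integral_mono_on hT.le (hgint.mono_set hsub1)
            (hucont.intervalIntegrable _ _) fun t _ => ?_
          refine Finset.sum_le_sum fun l _ => ?_
          by_cases ht : t < T
          · simp [hg, ht]
          · simp [hg, ht]
  -- The closing condition reads `(1 - Φ S * Φ T) v = Φ S (x T)`. Since `Φ S → 0`, it is solvable
  -- for large `S`, with a solution tending to `0`; the estimate for the motion from rest is the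
  -- limit.
  have hG : Tendsto (fun S => 1 - Φ S * Φ T) atTop (𝓝 1) := by
    simpa using (hΦlim.mul_const (Φ T)).const_sub 1
  have hunits : ∀ᶠ S in atTop, IsUnit (1 - Φ S * Φ T) :=
    hG.eventually (Units.isOpen.mem_nhds isUnit_one)
  have hinv : Tendsto (fun S => Ring.inverse (1 - Φ S * Φ T)) atTop (𝓝 1) := by
    have := (NormedRing.inverse_continuousAt (1 : ((Fin n → ℂ) →L[ℂ] (Fin n → ℂ))ˣ)).tendsto
    simp only [Units.val_one, Ring.inverse_one] at this
    exact this.comp hG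
  have hvlim : Tendsto (fun S => Ring.inverse (1 - Φ S * Φ T) (Φ S (x T))) atTop (𝓝 0) := by
    have h1 : Tendsto (fun S => (Φ S) (x T)) atTop (𝓝 0) := by
      simpa [Function.comp_def] using ((ContinuousLinearMap.apply ℂ (Fin n → ℂ) (x T)).continuous.tendsto 0).comp hΦlim
    have h2 := (isBoundedBilinearMap_apply (𝕜 := ℂ) (E := Fin n → ℂ) (F := Fin n → ℂ)).continuous.tendsto
      (1, 0)
    simpa [Function.comp_def] using h2.comp (hinv.prodMk_nhds h1)
  have hJ : Continuous fun v => ∫ t in (0 : ℝ)..T, ∑ k, ‖(C *ᵥ (x t + Φ t v)) k‖ ^ 2 := by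
    refine intervalIntegral.continuous_parametric_intervalIntegral_of_continuous' ?_ 0 T
    have : Continuous fun q : (Fin n → ℂ) × ℝ => C *ᵥ (x q.2 + Φ q.2 q.1) := by fun_prop
    change Continuous fun q : (Fin n → ℂ) × ℝ => ∑ k, ‖(C *ᵥ (x q.2 + Φ q.2 q.1)) k‖ ^ 2
    fun_prop
  have hlim := (hJ.tendsto 0).comp hvlim
  simp only [map_zero, add_zero] at hlim
  refine le_of_tendsto hlim ?_
  filter_upwards [hunits, eventually_gt_atTop 0] with S hS hSpos
  refine hstep S hSpos _ ?_
  have h1 : (1 - Φ S * Φ T) (Ring.inverse (1 - Φ S * Φ T) (Φ S (x T))) = Φ S (x T) := by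
    rw [← mul_apply_eq_comp, Ring.mul_inverse_cancel _ hS]; rfl
  rw [map_add]
  conv_lhs => rw [← h1]
  simp

theorem Matrix.map_ofReal_mul {p q r : ℕ} (M : Matrix (Fin p) (Fin q) ℝ)
    (N : Matrix (Fin q) (Fin r) ℝ) :
    (M * N).map Complex.ofReal = M.map Complex.ofReal * N.map Complex.ofReal :=
  Matrix.map_mul (f := Complex.ofRealHom)

/-! ### The network Laplacian and the undisturbed linear dynamics. -/

namespace NetworkModel

variable {N n m : ℕ} (net : NetworkModel N n m)

/-- The Laplacian of the network, scaled by the coupling strength. -/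
noncomputable def laplacian : Matrix (Fin N) (Fin N) ℝ :=
  Matrix.of fun i j => if i = j then net.localGain i else -(net.α * net.g i j)

theorem sum_laplacian_smul {V : Type*} [AddCommGroup V] [Module ℝ V] (x : Fin N → V) (i : Fin N) :
    ∑ j, net.laplacian i j • x j =
      net.localGain i • x i - ∑ j ∈ Finset.univ.erase i, (net.α * net.g i j) • x j := by
  rw [← Finset.add_sum_erase _ _ (Finset.mem_univ i), sub_eq_add_neg, ← Finset.sum_neg_distrib]
  congr 1
  · simp [laplacian]
  · refine Finset.sum_congr rfl fun j hj => ?_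
    simp [laplacian, (Finset.ne_of_mem_erase hj).symm]

theorem sum_laplacian (i : Fin N) : ∑ j, net.laplacian i j = 0 := by
  have := net.sum_laplacian_smul (fun _ => (1 : ℝ)) i
  simpa [localGain, Finset.mul_sum, -Finset.sum_erase_eq_sub] using this

theorem vectorField_apply (u : Fin N → Fin m → ℝ) (x : Fin N → Fin n → ℝ) (i : Fin N) :
    net.vectorField u x i = (net.A - net.localGain i • (net.B * net.C)) *ᵥ x i +
      net.B *ᵥ (∑ j ∈ Finset.univ.erase i, (net.α * net.g i j) • net.output x j + u i) := by
  have h : net.α • ∑ j ∈ Finset.univ.erase i, net.g i j • (net.output x j - net.output x i) =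
      ∑ j ∈ Finset.univ.erase i, (net.α * net.g i j) • net.output x j -
        net.localGain i • net.output x i := by
    simp only [smul_sub, Finset.sum_sub_distrib, Finset.smul_sum, smul_smul]
    rw [← Finset.sum_smul, localGain, Finset.mul_sum]
  rw [vectorField, h]
  simp only [Matrix.mulVec_add, Matrix.mulVec_sub, Matrix.sub_mulVec, Matrix.smul_mulVec, output,
    Matrix.mulVec_smul, Matrix.mulVec_mulVec]
  abel

/-- The undisturbed vector field as a linear map. -/
noncomputable def linearField : (Fin N → Fin n → ℝ) →ₗ[ℝ] (Fin N → Fin n → ℝ) :=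
  LinearMap.pi fun i => net.A.mulVecLin ∘ₗ LinearMap.proj i -
    (net.B * net.C).mulVecLin ∘ₗ ∑ j, net.laplacian i j • LinearMap.proj j

theorem linearField_apply (x : Fin N → Fin n → ℝ) (i : Fin N) :
    net.linearField x i = net.A *ᵥ x i - (net.B * net.C) *ᵥ ∑ j, net.laplacian i j • x j := by
  simp [linearField, Matrix.mulVec_sum, Matrix.mulVec_smul]

theorem linearField_eq_vectorField (x : Fin N → Fin n → ℝ) :
    net.linearField x = net.vectorField 0 x := by
  ext1 i
  rw [linearField_apply, vectorField_apply, sum_laplacian_smul]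
  have : ∑ j ∈ Finset.univ.erase i, (net.α * net.g i j) • net.output x j =
      net.C *ᵥ ∑ j ∈ Finset.univ.erase i, (net.α * net.g i j) • x j := by
    simp only [output, Matrix.mulVec_sum, Matrix.mulVec_smul]
  rw [this]
  simp only [Matrix.mulVec_sub, Matrix.sub_mulVec, Matrix.smul_mulVec, Pi.zero_apply, add_zero,
    Matrix.mulVec_smul, Matrix.mulVec_mulVec]
  abel

theorem exists_isTrajectory_zero (x₀ : Fin N → Fin n → ℝ) :
    ∃ x, x 0 = x₀ ∧ net.IsTrajectory 0 x ∧ ∀ t, HasDerivAt x (net.linearField (x t)) t := by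
  set F := net.linearField.toContinuousLinearMap with hF
  have hd : ∀ t : ℝ, HasDerivAt (fun t : ℝ => NormedSpace.exp (t • F) x₀)
      (net.linearField (NormedSpace.exp (t • F) x₀)) t := fun t =>
    (ContinuousLinearMap.apply ℝ (Fin N → Fin n → ℝ) x₀).hasFDerivAt.comp_hasDerivAt t
      (hasDerivAt_exp_smul_const' (𝕂 := ℝ) F t)
  have hc : Continuous fun t : ℝ => NormedSpace.exp (t • F) x₀ :=
    continuous_iff_continuousAt.2 fun t => (hd t).continuousAt
  have h0 : NormedSpace.exp ((0 : ℝ) • F) x₀ = x₀ := by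
    have : (0 : ℝ) • F = 0 := zero_smul ℝ F
    rw [this]
    simp
  refine ⟨_, h0, ⟨hc.continuousOn, fun t ht => ?_⟩, hd⟩
  have hcd : Continuous fun t : ℝ => net.linearField (NormedSpace.exp (t • F) x₀) :=
    F.continuous.comp hc
  have := intervalIntegral.integral_eq_sub_of_hasDerivAt (fun s _ => hd s)
    (hcd.intervalIntegrable 0 t)
  simp only [linearField_eq_vectorField] at this
  simp only [Pi.zero_apply]
  rw [this, add_sub_cancel]

/-! ### Modes transverse to the synchronization manifold. -/

/-- The linear functional `x ↦ ∑ i k, u i * p k * x i k`. -/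
noncomputable def pairing (u : Fin N → ℂ) (p : Fin n → ℂ) : (Fin N → Fin n → ℝ) →ₗ[ℝ] ℂ :=
  ∑ i, ∑ k, (u i * p k) • (Complex.ofRealCLM.toLinearMap ∘ₗ LinearMap.proj k ∘ₗ LinearMap.proj i)

theorem pairing_apply (u : Fin N → ℂ) (p : Fin n → ℂ) (x : Fin N → Fin n → ℝ) :
    pairing u p x = ∑ i, ∑ k, (u i * p k) * (x i k : ℂ) := by
  simp [pairing]

theorem pairing_eq_dotProduct (u : Fin N → ℂ) (p : Fin n → ℂ) (x : Fin N → Fin n → ℝ) :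
    pairing u p x = (u ᵥ* (Matrix.of x).map Complex.ofReal) ⬝ᵥ p := by
  simp only [pairing_apply, Matrix.vecMul, dotProduct, Finset.sum_mul]
  rw [Finset.sum_comm]
  refine Finset.sum_congr rfl fun k _ => Finset.sum_congr rfl fun i _ => ?_
  simp only [Matrix.map_apply, Matrix.of_apply]
  ring

theorem pairing_eq_zero_of_mem_syncManifold {u : Fin N → ℂ} (hu : ∑ i, u i = 0) (p : Fin n → ℂ)
    {x : Fin N → Fin n → ℝ} (hx : x ∈ syncManifold N n) : pairing u p x = 0 := by
  rw [pairing_apply]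
  rcases isEmpty_or_nonempty (Fin N) with h | ⟨⟨i₀⟩⟩
  · simp
  · calc ∑ i, ∑ k, (u i * p k) * (x i k : ℂ)
        = ∑ i, u i * ∑ k, p k * (x i₀ k : ℂ) := by
          refine Finset.sum_congr rfl fun i _ => ?_
          rw [hx i i₀, Finset.mul_sum]
          simp only [mul_assoc]
      _ = 0 := by rw [← Finset.sum_mul, hu, zero_mul]

theorem norm_pairing_le (u : Fin N → ℂ) (p : Fin n → ℂ) (x : Fin N → Fin n → ℝ) :
    ‖pairing u p x‖ ≤ (∑ i, ∑ k, ‖u i * p k‖) * ‖x‖ := by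
  rw [pairing_apply, Finset.sum_mul]
  refine norm_sum_le_of_le _ fun i _ => ?_
  rw [Finset.sum_mul]
  refine norm_sum_le_of_le _ fun k _ => ?_
  rw [norm_mul, Complex.norm_real]
  gcongr
  exact (norm_le_pi_norm (x i) k).trans (norm_le_pi_norm x i)

/-- The left eigenvector `u` of the Laplacian decouples the network into the single system `A - l
BC`, on which `p` acts as a left eigenvector; the functional then evolves by a scalar equation. -/
theorem pairing_linearField {u : Fin N → ℂ} {l : ℂ} {p : Fin n → ℂ} {μ : ℂ}
    (hu : u ᵥ* net.laplacian.map Complex.ofReal = l • u)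
    (hp : p ᵥ* (net.A.map Complex.ofReal -
      l • (net.B.map Complex.ofReal * net.C.map Complex.ofReal)) = μ • p)
    (x : Fin N → Fin n → ℝ) : pairing u p (net.linearField x) = μ * pairing u p x := by
  have h1 : Matrix.of (net.linearField x) = Matrix.of x * net.Aᵀ -
      net.laplacian * Matrix.of x * (net.B * net.C)ᵀ := by
    ext i k
    have h2 : (net.laplacian * Matrix.of x) i = ∑ j, net.laplacian i j • x j := by
      ext k; simp [Matrix.mul_apply]
    rw [Matrix.of_apply, linearField_apply, Matrix.sub_apply, Pi.sub_apply, ← h2,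
      ← Matrix.vecMul_transpose, ← Matrix.vecMul_transpose]
    rfl
  have h2 : (Matrix.of (net.linearField x)).map Complex.ofReal =
      (Matrix.of x).map Complex.ofReal * (net.A.map Complex.ofReal)ᵀ -
        net.laplacian.map Complex.ofReal * (Matrix.of x).map Complex.ofReal *
          (net.B.map Complex.ofReal * net.C.map Complex.ofReal)ᵀ := by
    rw [h1, Matrix.map_sub _ Complex.ofReal_sub]
    simp only [Matrix.map_ofReal_mul, Matrix.transpose_map]
  have h3 : u ᵥ* (Matrix.of (net.linearField x)).map Complex.ofReal =
      (net.A.map Complex.ofReal - l • (net.B.map Complex.ofReal * net.C.map Complex.ofReal)) *ᵥ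
        (u ᵥ* (Matrix.of x).map Complex.ofReal) := by
    rw [h2, Matrix.vecMul_sub, ← Matrix.vecMul_vecMul, ← Matrix.vecMul_vecMul,
      ← Matrix.vecMul_vecMul, hu, Matrix.vecMul_transpose, Matrix.vecMul_transpose,
      Matrix.sub_mulVec, Matrix.smul_mulVec, Matrix.smul_vecMul, Matrix.mulVec_smul]
  rw [pairing_eq_dotProduct, pairing_eq_dotProduct, h3, dotProduct_comm, Matrix.dotProduct_mulVec,
    hp, smul_dotProduct, dotProduct_comm, smul_eq_mul]

/-- An eigenvalue `μ` with `0 ≤ μ.re` would give a functional that evolves as `exp (μ t)` and hence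
does not decay. As `u` has zero sum, it vanishes on the synchronization manifold and is bounded by
the distance to it, contradicting attractivity. -/
theorem SyncAsymptoticallyStable.isHurwitz {net : NetworkModel N n m}
    (hsync : net.SyncAsymptoticallyStable) {u : Fin N → ℂ} {l : ℂ} (hu0 : u ≠ 0)
    (husum : ∑ i, u i = 0) (hu : u ᵥ* net.laplacian.map Complex.ofReal = l • u) :
    (net.A.map Complex.ofReal -
      l • (net.B.map Complex.ofReal * net.C.map Complex.ofReal)).IsHurwitz := by
  intro μ hμ hdet
  obtain ⟨p, hp0, hp⟩ := Matrix.exists_vecMul_eq_zero_iff.2 hdet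
  rw [Matrix.vecMul_sub, Matrix.vecMul_smul, Matrix.vecMul_one, sub_eq_zero, eq_comm] at hp
  obtain ⟨i₀, hi₀⟩ := Function.ne_iff.1 hu0
  obtain ⟨k₀, hk₀⟩ := Function.ne_iff.1 hp0
  obtain ⟨δ, hδ, hattr⟩ := hsync.2
  have hzero : (0 : Fin N → Fin n → ℝ) ∈ syncManifold N n := fun i j => rfl
  -- The initial state has one nonzero coordinate, chosen where `u` and `p` are nonzero, and is
  -- within `δ` of the manifold point `0`.
  obtain ⟨x, hx0, hxt, hxd⟩ :=
    net.exists_isTrajectory_zero (Pi.single i₀ (Pi.single k₀ (δ / 2)))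
  have hlim := hattr x hxt (by
    refine (Metric.infDist_le_dist_of_mem hzero).trans_lt ?_
    rw [dist_zero_right, hx0, Pi.norm_single, Pi.norm_single, Real.norm_eq_abs,
      abs_of_pos (by linarith)]
    linarith)
  set K : ℝ := (∑ i, ∑ k, ‖u i * p k‖) + 1 with hK
  have hKpos : 0 < K := by positivity
  have hbound : ∀ y, ‖pairing u p y‖ ≤ K * Metric.infDist y (syncManifold N n) := by
    intro y
    rw [← div_le_iff₀' hKpos]
    refine (Metric.le_infDist ⟨_, hzero⟩).2 fun {s} hs => ?_
    rw [div_le_iff₀' hKpos, dist_eq_norm]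
    have h1 : pairing u p y = pairing u p (y - s) := by
      rw [map_sub, pairing_eq_zero_of_mem_syncManifold husum p hs, sub_zero]
    rw [h1]
    refine (norm_pairing_le u p _).trans ?_
    gcongr
    linarith
  have hder : ∀ t, HasDerivAt (fun t => pairing u p (x t)) (μ * pairing u p (x t)) t := by
    intro t
    have h1 := (pairing u p).toContinuousLinearMap.hasFDerivAt.comp_hasDerivAt t (hxd t)
    have h2 := net.pairing_linearField hu hp (x t)
    rw [← h2]
    exact h1
  have hsol : ∀ t : ℝ, pairing u p (x t) = Complex.exp (μ * t) * pairing u p (x 0) := by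
    have hE : ∀ t : ℝ, HasDerivAt (fun t : ℝ => Complex.exp (-μ * t))
        (Complex.exp (-μ * t) * -μ) t := by
      intro t
      have h1 : HasDerivAt (fun z : ℂ => Complex.exp (-μ * z)) (Complex.exp (-μ * t) * -μ) (t : ℂ) := by
        simpa using ((hasDerivAt_id (t : ℂ)).const_mul (-μ)).cexp
      exact h1.comp_ofReal
    have hprod : ∀ t : ℝ, HasDerivAt (fun t : ℝ => Complex.exp (-μ * t) * pairing u p (x t)) 0 t :=
      fun t => ((hE t).mul (hder t)).congr_deriv (by ring)
    intro t
    have h1 := is_const_of_deriv_eq_zero (fun t => (hprod t).differentiableAt)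
      (fun t => (hprod t).deriv) t 0
    simp only [Complex.ofReal_zero, mul_zero, Complex.exp_zero, one_mul] at h1
    rw [← h1, ← mul_assoc, ← Complex.exp_add]
    simp
  have hpos : 0 < ‖pairing u p (x 0)‖ := by
    rw [norm_pos_iff, hx0, pairing_apply, Finset.sum_eq_single i₀, Finset.sum_eq_single k₀]
    · simpa [hδ.ne'] using ⟨hi₀, hk₀⟩
    · intro k _ hk; simp [hk]
    · simp
    · intro i _ hi; simp [hi]
    · simp
  have hge : ∀ t : ℝ, 0 ≤ t →
      ‖pairing u p (x 0)‖ ≤ K * Metric.infDist (x t) (syncManifold N n) := by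
    intro t ht
    refine le_trans ?_ (hbound (x t))
    rw [hsol t, norm_mul, Complex.norm_exp]
    refine le_mul_of_one_le_left (norm_nonneg _) (Real.one_le_exp ?_)
    simpa using mul_nonneg hμ ht
  have := ge_of_tendsto (hlim.const_mul K) (eventually_ge_atTop 0 |>.mono hge)
  rw [mul_zero] at this
  exact hpos.not_ge this

/-- Since the Laplacian kills the constant vector, row vectors with zero sum form an invariant
subspace, nonzero once there are two vertices, so an eigenvector exists there. -/
theorem exists_vecMul_laplacian_eq_smul (hN : ∃ i j : Fin N, i ≠ j) :
    ∃ (u : Fin N → ℂ) (l : ℂ), u ≠ 0 ∧ ∑ i, u i = 0 ∧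
      u ᵥ* net.laplacian.map Complex.ofReal = l • u := by
  set L := net.laplacian.map Complex.ofReal with hL
  set W : Submodule ℂ (Fin N → ℂ) := LinearMap.ker (∑ i, LinearMap.proj i) with hW
  have hWmem : ∀ u, u ∈ W ↔ ∑ i, u i = 0 := fun u => by simp [hW]
  have hL1 : L *ᵥ 1 = 0 := by
    ext i
    have := net.sum_laplacian i
    simp only [hL, Matrix.mulVec, dotProduct, Pi.one_apply, mul_one, Matrix.map_apply,
      Pi.zero_apply]
    exact_mod_cast this
  have hinv : ∀ u ∈ W, L.vecMulLinear u ∈ W := by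
    intro u _
    rw [hWmem]
    have : ∑ i, (u ᵥ* L) i = (u ᵥ* L) ⬝ᵥ 1 := by simp [dotProduct]
    rw [Matrix.vecMulLinear_apply, this, ← Matrix.dotProduct_mulVec, hL1, dotProduct_zero]
  obtain ⟨i, j, hij⟩ := hN
  have hnt : Nontrivial W := by
    refine ⟨⟨⟨Pi.single i 1 - Pi.single j 1, ?_⟩, 0, fun h => ?_⟩⟩
    · rw [hWmem]; simp
    · have := congrFun (congrArg Subtype.val h) i
      simp [hij] at this
  obtain ⟨l, hl⟩ := Module.End.exists_eigenvalue (L.vecMulLinear.restrict hinv)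
  obtain ⟨⟨u, hu⟩, hev⟩ := hl.exists_hasEigenvector
  refine ⟨u, l, fun h => hev.2 (Subtype.ext h), (hWmem u).1 hu, ?_⟩
  exact congrArg Subtype.val hev.apply_eq_smul

/-! ### Gershgorin discs and stability at the local gains. -/

theorem localGain_eq_abs_or (net : NetworkModel N n m) :
    (∀ i, net.localGain i = |net.localGain i|) ∨ ∀ i, net.localGain i = -|net.localGain i| := by
  have hs : ∀ i, 0 ≤ ∑ j ∈ Finset.univ.erase i, net.g i j := fun i =>
    Finset.sum_nonneg fun j hj => net.g_nonneg i j (Finset.ne_of_mem_erase hj).symm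
  rcases le_total 0 net.α with h | h
  · exact Or.inl fun i => (abs_of_nonneg (mul_nonneg h (hs i))).symm
  · right
    intro i
    have : net.localGain i ≤ 0 := mul_nonpos_of_nonpos_of_nonneg h (hs i)
    rw [abs_of_nonpos this, neg_neg]

/-- All local gains have the sign of `α`, so the discs centred at them that pass through `0` are
tangent there on the same side, hence nested. -/
theorem norm_sub_localGain_le {i j : Fin N} (hij : |net.localGain i| ≤ |net.localGain j|)
    {l : ℂ} (hl : ‖l - net.localGain i‖ ≤ |net.localGain i|) :
    ‖l - net.localGain j‖ ≤ |net.localGain j| := by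
  have h1 : ‖(net.localGain i : ℂ) - net.localGain j‖ = |net.localGain j| - |net.localGain i| := by
    rw [← Complex.ofReal_sub, Complex.norm_real, Real.norm_eq_abs]
    rcases net.localGain_eq_abs_or with h | h
    · conv_lhs => rw [h i, h j]
      rw [abs_sub_comm, abs_of_nonneg (sub_nonneg.2 hij)]
    · conv_lhs => rw [h i, h j]
      rw [abs_of_nonneg (by linarith)]; ring
  calc ‖l - net.localGain j‖ = ‖(l - net.localGain i) + (net.localGain i - net.localGain j)‖ := by
        congr 1; ring
    _ ≤ ‖l - net.localGain i‖ + ‖(net.localGain i : ℂ) - net.localGain j‖ := norm_add_le _ _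
    _ ≤ _ := by rw [h1]; linarith

/-- Gershgorin's theorem: the off-diagonal moduli of row `i` add up to the modulus of its diagonal
entry. -/
theorem exists_norm_sub_localGain_le {u : Fin N → ℂ} {l : ℂ} (hu0 : u ≠ 0)
    (hu : u ᵥ* net.laplacian.map Complex.ofReal = l • u) :
    ∃ i, ‖l - net.localGain i‖ ≤ |net.localGain i| := by
  set L := net.laplacian.map Complex.ofReal with hL
  have hdet : (l • (1 : Matrix (Fin N) (Fin N) ℂ) - L).det = 0 := by
    rw [← Matrix.exists_vecMul_eq_zero_iff]
    refine ⟨u, hu0, ?_⟩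
    rw [Matrix.vecMul_sub, Matrix.vecMul_smul, Matrix.vecMul_one, hu, sub_self]
  obtain ⟨v, hv0, hv⟩ := (L.det_smul_one_sub_eq_zero_iff_exists_mulVec l).1 hdet
  have hev : Module.End.HasEigenvalue (Matrix.toLin' L) l :=
    Module.End.hasEigenvalue_of_hasEigenvector (x := v)
      ⟨Module.End.mem_eigenspace_iff.2 (by simpa using hv), hv0⟩
  obtain ⟨i, hi⟩ := eigenvalue_mem_ball hev
  refine ⟨i, ?_⟩
  rw [Metric.mem_closedBall, dist_eq_norm] at hi
  have h1 : L i i = net.localGain i := by simp [hL, laplacian]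
  have h2 : ∑ j ∈ Finset.univ.erase i, ‖L i j‖ = |net.localGain i| := by
    rw [localGain, abs_mul, abs_of_nonneg (Finset.sum_nonneg fun j hj =>
      net.g_nonneg i j (Finset.ne_of_mem_erase hj).symm), Finset.mul_sum]
    refine Finset.sum_congr rfl fun j hj => ?_
    have hij := (Finset.ne_of_mem_erase hj).symm
    simp [hL, laplacian, hij, abs_of_nonneg (net.g_nonneg i j hij)]
  rwa [h1, h2] at hi

/-- Under synchronization stability and the gain condition, every subsystem that receives coupling
is stable in closed loop with its local gain. -/
theorem SyncAsymptoticallyStable.isHurwitz_localGain {net : NetworkModel N n m}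
    (hsync : net.SyncAsymptoticallyStable) (hgain : ∀ i : Fin N, net.peakGain i ≤ 1)
    {b : Fin N} (hb : net.localGain b ≠ 0) :
    ((net.A - net.localGain b • (net.B * net.C)).map Complex.ofReal).IsHurwitz := by
  have hN : ∃ i j : Fin N, i ≠ j := by
    by_contra! h
    refine hb ?_
    rw [localGain, Finset.sum_eq_zero, mul_zero]
    intro j hj
    exact absurd (h j b) (Finset.ne_of_mem_erase hj)
  obtain ⟨u, l, hu0, husum, hu⟩ := net.exists_vecMul_laplacian_eq_smul hN
  obtain ⟨i, hi⟩ := net.exists_norm_sub_localGain_le hu0 hu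
  obtain ⟨j, -, hj⟩ := Finset.exists_max_image Finset.univ (fun i => |net.localGain i|)
    ⟨b, Finset.mem_univ b⟩
  have hlj := net.norm_sub_localGain_le (hj i (Finset.mem_univ i)) hi
  have hbj := hj b (Finset.mem_univ b)
  have hbpos : 0 < |net.localGain b| := abs_pos.2 hb
  have hjpos : 0 < |net.localGain j| := hbpos.trans_le hbj
  have hjne : (net.localGain j : ℂ) ≠ 0 := by exact_mod_cast abs_pos.1 hjpos
  have hbdist : ‖(net.localGain b : ℂ) - net.localGain j‖ < |net.localGain j| := by
    rw [← Complex.ofReal_sub, Complex.norm_real, Real.norm_eq_abs]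
    rcases net.localGain_eq_abs_or with h | h
    · conv_lhs => rw [h b, h j]
      rw [abs_lt]; constructor <;> linarith
    · conv_lhs => rw [h b, h j]
      rw [abs_lt]; constructor <;> linarith
  have hH := hsync.isHurwitz hu0 husum hu
  set Ac := net.A.map Complex.ofReal
  set Bc := net.B.map Complex.ofReal
  set Cc := net.C.map Complex.ofReal
  have hmap : ∀ k : ℝ, (net.A - k • (net.B * net.C)).map Complex.ofReal =
      Ac - (k : ℂ) • (Bc * Cc) := by
    intro k
    rw [Matrix.map_sub _ Complex.ofReal_sub, Matrix.map_smul' _ _ _ Complex.ofReal_mul]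
    congr 2
    exact Matrix.map_ofReal_mul _ _
  have hshift : ∀ s c : ℂ, s • (1 : Matrix (Fin n) (Fin n) ℂ) - (Ac - c • (Bc * Cc)) =
      s • 1 - (Ac - (net.localGain j : ℂ) • (Bc * Cc)) + (c - net.localGain j) • (Bc * Cc) := by
    intro s c
    rw [sub_smul]
    abel
  -- Relative to the gain `k_j`, the feedback `c` is a perturbation `c - k_j`. The auxiliary
  -- feedback that clears the axis is `l - k_j`, since `A - l BC` is Hurwitz.
  have haxis : ∀ c : ℂ, ‖c - net.localGain j‖ < |net.localGain j| → ∀ ω : ℝ,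
      ((ω * Complex.I) • (1 : Matrix (Fin n) (Fin n) ℂ) - (Ac - c • (Bc * Cc))).det ≠ 0 := by
    intro c hc ω
    rw [hshift]
    refine Matrix.det_ne_zero_of_contractive _ Bc Cc hjne ?_ (c₀ := l - net.localGain j) ?_ ?_ ω
    · intro ω hω v
      have hpen : net.localPencil j (ω * Complex.I) =
          (ω * Complex.I) • 1 - (Ac - (net.localGain j : ℂ) • (Bc * Cc)) := by
        rw [localPencil, hmap]
      have := net.sum_norm_sq_localTransfer_le (hgain j) ω (by rwa [hpen]) v
      rwa [localTransfer, hpen] at this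
    · intro ω
      rw [← hshift]
      exact hH _ (by simp)
    · simpa using hc
  rw [hmap]
  have hpath := Matrix.isHurwitz_of_path
    (M := fun t : unitInterval => Ac - (l + (t : ℝ) * (net.localGain b - l) : ℂ) • (Bc * Cc))
    (by fun_prop) ?_ (by simpa using hH)
  · simpa using hpath
  · intro t ω
    -- The endpoint `l` may lie on the boundary circle, where `haxis` does not apply; there the
    -- Hurwitz property is known. Every later point of the segment is interior.
    rcases eq_or_lt_of_le t.2.1 with ht | ht
    · rw [← ht]
      simpa using hH (ω * Complex.I) (by simp)
    · refine haxis _ ?_ ω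
      have ht1 : (t : ℝ) ≤ 1 := t.2.2
      calc ‖l + (t : ℝ) * (net.localGain b - l) - net.localGain j‖
          = ‖((1 - t : ℝ) : ℂ) * (l - net.localGain j) +
              ((t : ℝ) : ℂ) * (net.localGain b - net.localGain j)‖ := by
            congr 1; push_cast; ring
        _ ≤ (1 - t) * ‖l - net.localGain j‖ + t * ‖(net.localGain b : ℂ) - net.localGain j‖ := by
            refine (norm_add_le _ _).trans_eq ?_
            rw [norm_mul, norm_mul, Complex.norm_real, Complex.norm_real, Real.norm_eq_abs,
              Real.norm_eq_abs, abs_of_nonneg (sub_nonneg.2 ht1), abs_of_pos ht]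
        _ < |net.localGain j| := by
            have h1 := mul_le_mul_of_nonneg_left hlj (sub_nonneg.2 ht1)
            have h2 := mul_lt_mul_of_pos_left hbdist ht
            linarith

end NetworkModel

/-! ### Responses away from the source and energy estimates. -/

namespace NetworkModel

variable {N n m : ℕ} {net : NetworkModel N n m}

theorem vectorField_eq_linearField_add (net : NetworkModel N n m) (u : Fin N → Fin m → ℝ)
    (x : Fin N → Fin n → ℝ) :
    net.vectorField u x = net.linearField x + fun i => net.B *ᵥ u i := by
  ext1 i
  rw [linearField_eq_vectorField, Pi.add_apply, vectorField_apply, vectorField_apply,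
    Pi.zero_apply, add_zero, Matrix.mulVec_add, add_assoc]

/-- The sign of `α` cancels in the quotient; for zero gain the quotient is `0` by convention. -/
theorem weight_div_localGain_nonneg (net : NetworkModel N n m) (b : Fin N) :
    ∀ j ∈ Finset.univ.erase b, 0 ≤ net.α * net.g b j / net.localGain b := by
  intro j hj
  have hg := net.g_nonneg b j (Finset.ne_of_mem_erase hj).symm
  have hsum : 0 ≤ ∑ j ∈ Finset.univ.erase b, net.g b j :=
    Finset.sum_nonneg fun j hj => net.g_nonneg b j (Finset.ne_of_mem_erase hj).symm
  rcases le_total 0 net.α with h | h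
  · exact div_nonneg (mul_nonneg h hg) (mul_nonneg h hsum)
  · exact div_nonneg_of_nonpos (mul_nonpos_of_nonpos_of_nonneg h hg)
      (mul_nonpos_of_nonpos_of_nonneg h hsum)

theorem sum_weight_div_localGain (net : NetworkModel N n m) {b : Fin N}
    (hb : net.localGain b ≠ 0) :
    ∑ j ∈ Finset.univ.erase b, net.α * net.g b j / net.localGain b = 1 := by
  rw [← Finset.sum_div, ← Finset.mul_sum]
  exact div_self hb

namespace IsDisturbanceResponse

variable {s : Fin N} {w : ℝ → Fin m → ℝ} {x : ℝ → Fin N → Fin n → ℝ}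

/-- Freezing the state at negative times gives a function continuous on all of `ℝ`, as the calculus
lemmas below need. -/
theorem continuous_max (hx : net.IsDisturbanceResponse s w x) :
    Continuous fun t => x (max t 0) :=
  hx.1.1.comp_continuous (by fun_prop) fun t => le_max_right t 0

theorem apply_eq_integral (hx : net.IsDisturbanceResponse s w x) (hw : IsDirichlet w)
    {i : Fin N} (hi : i ≠ s) {t : ℝ} (ht : 0 ≤ t) :
    x t i = ∫ τ in (0 : ℝ)..t, net.linearField (x (max τ 0)) i := by
  rcases ht.eq_or_lt with rfl | htpos
  · simp [hx.2]
  have h1 := hx.1.2 t ht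
  rw [hx.2, zero_add] at h1
  set L : (Fin m → ℝ) →L[ℝ] (Fin N → Fin n → ℝ) :=
    (LinearMap.single ℝ (fun _ : Fin N => Fin n → ℝ) s ∘ₗ net.B.mulVecLin).toContinuousLinearMap
    with hL
  have hLapp : ∀ v i, i ≠ s → L v i = 0 := by
    intro v i hi
    simp [hL, hi]
  have hcont : Continuous fun τ => net.linearField (x (max τ 0)) :=
    net.linearField.toContinuousLinearMap.continuous.comp hx.continuous_max
  have h2 : ∫ τ in (0 : ℝ)..t, net.vectorField (sourceInput s w τ) (x τ) =
      ∫ τ in (0 : ℝ)..t, (net.linearField (x (max τ 0)) + L (w τ)) := by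
    refine intervalIntegral.integral_congr fun τ hτ => ?_
    rw [uIcc_of_le ht] at hτ
    simp only [max_eq_left hτ.1, vectorField_eq_linearField_add]
    congr 1
    ext1 i
    by_cases hi : i = s
    · subst hi; simp [sourceInput, hL]
    · simp [sourceInput, hL, hi]
  -- The integral is of the whole network vector; integrability of the source component is needed
  -- before coordinate `i` can be taken inside.
  have hLw : IntervalIntegrable (fun τ => L (w τ)) volume 0 t := by
    rw [intervalIntegrable_iff_integrableOn_Ioc_of_le ht]
    exact L.integrable_comp ((hw.integrable t htpos).mono_set Ioc_subset_Icc_self)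
  have h3 := (ContinuousLinearMap.proj (R := ℝ) (φ := fun _ : Fin N => Fin n → ℝ)
    i).intervalIntegral_comp_comm ((hcont.intervalIntegrable 0 t).add hLw)
  rw [h1, h2]
  refine h3.symm.trans (intervalIntegral.integral_congr fun τ _ => ?_)
  simp [hLapp _ i hi]

theorem hasDerivAt_apply (hx : net.IsDisturbanceResponse s w x) (hw : IsDirichlet w)
    {i : Fin N} (hi : i ≠ s) {t : ℝ} (ht : 0 < t) :
    HasDerivAt (fun t => x (max t 0) i) (net.linearField (x (max t 0)) i) t := by
  have hcont : Continuous fun τ => net.linearField (x (max τ 0)) i :=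
    (continuous_apply i).comp
      (net.linearField.toContinuousLinearMap.continuous.comp hx.continuous_max)
  refine (hcont.integral_hasStrictDerivAt 0 t).hasDerivAt.congr_of_eventuallyEq ?_
  filter_upwards [Ioi_mem_nhds ht] with τ hτ
  rw [max_eq_left (le_of_lt hτ)]
  exact hx.apply_eq_integral hw hi (le_of_lt hτ)

theorem hasDerivWithinAt_apply (hx : net.IsDisturbanceResponse s w x) (hw : IsDirichlet w)
    {i : Fin N} (hi : i ≠ s) {t : ℝ} (ht : 0 ≤ t) :
    HasDerivWithinAt (fun t => x (max t 0) i) (net.linearField (x (max t 0)) i) (Ici t) t := by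
  have hcont : Continuous fun τ => net.linearField (x (max τ 0)) i :=
    (continuous_apply i).comp
      (net.linearField.toContinuousLinearMap.continuous.comp hx.continuous_max)
  have heq : ∀ τ, 0 ≤ τ → x (max τ 0) i = ∫ σ in (0 : ℝ)..τ, net.linearField (x (max σ 0)) i := by
    intro τ hτ
    rw [max_eq_left hτ]
    exact hx.apply_eq_integral hw hi hτ
  exact (hcont.integral_hasStrictDerivAt 0 t).hasDerivAt.hasDerivWithinAt.congr
    (fun τ hτ => heq τ (ht.trans hτ)) (heq t ht)

/-- Vertices that receive no coupling from outside, and do not contain the source, stay at rest. -/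
theorem apply_eq_zero_of_forall_weight_eq_zero (hx : net.IsDisturbanceResponse s w x)
    (hw : IsDirichlet w) {S : Finset (Fin N)} (hs : s ∉ S)
    (hS : ∀ i ∈ S, ∀ j ∉ S, net.α * net.g i j = 0) {t : ℝ} (ht : 0 ≤ t) {i : Fin N}
    (hi : i ∈ S) : x t i = 0 := by
  set P : (Fin N → Fin n → ℝ) →ₗ[ℝ] (Fin N → Fin n → ℝ) :=
    LinearMap.pi fun i => if i ∈ S then LinearMap.proj i else 0 with hP
  have hPmem : ∀ y, ∀ i ∈ S, P y i = y i := fun y i hi => by simp [hP, hi]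
  have hPnot : ∀ y, ∀ i ∉ S, P y i = 0 := fun y i hi => by simp [hP, hi]
  -- The state on `S` evolves autonomously, because the coupling from outside vanishes. It therefore
  -- agrees with the zero solution by uniqueness.
  have hfield : ∀ y, ∀ i ∈ S, net.linearField (P y) i = net.linearField y i := by
    intro y i hi
    rw [linearField_apply, linearField_apply, hPmem y i hi]
    congr 2
    refine Finset.sum_congr rfl fun j _ => ?_
    by_cases hj : j ∈ S
    · rw [hPmem y j hj]
    · have hij : i ≠ j := fun h => hj (h ▸ hi)
      simp [laplacian, hij, hS i hi j hj]
  set V := (P ∘ₗ net.linearField).toContinuousLinearMap with hV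
  set z : ℝ → Fin N → Fin n → ℝ := fun t => P (x (max t 0)) with hz
  have hzc : Continuous z := P.toContinuousLinearMap.continuous.comp hx.continuous_max
  have hzd : ∀ τ ∈ Ico 0 t, HasDerivWithinAt z (V (z τ)) (Ici τ) τ := by
    intro τ hτ
    rw [hasDerivWithinAt_pi]
    intro j
    by_cases hj : j ∈ S
    · have hjs : j ≠ s := fun h => hs (h ▸ hj)
      have h1 : V (z τ) j = net.linearField (x (max τ 0)) j := by
        change P (net.linearField (P (x (max τ 0)))) j = _
        rw [hPmem _ j hj, hfield _ j hj]
      rw [h1]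
      have h2 := hx.hasDerivWithinAt_apply hw hjs hτ.1
      simpa only [hz, hPmem _ j hj] using h2
    · have h1 : V (z τ) j = 0 := hPnot _ j hj
      rw [h1]
      simp only [hz, hPnot _ j hj]
      exact hasDerivWithinAt_const _ _ _
  have huniq := ODE_solution_unique_of_mem_Icc_right (v := fun _ => V) (s := fun _ => univ)
    (K := ‖V‖₊) (f := z) (g := fun _ => 0) (a := 0) (b := t)
    (fun _ _ => V.lipschitz.lipschitzOnWith) hzc.continuousOn hzd (fun _ _ => mem_univ _)
    continuousOn_const (fun τ _ => by simpa using hasDerivWithinAt_const τ (Ici τ) (0 : Fin N → Fin n → ℝ))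
    (fun _ _ => mem_univ _) (by simp [hz, hx.2])
  have h1 := congrFun (huniq ⟨ht, le_rfl⟩) i
  simpa [hz, hPmem _ i hi, max_eq_left ht] using h1

/-- The energy of a vertex away from the source is at most the weighted mean of the energies of
its in-neighbours. -/
theorem energy_le_sum (hx : net.IsDisturbanceResponse s w x) (hw : IsDirichlet w)
    (hsync : net.SyncAsymptoticallyStable) (hgain : ∀ i : Fin N, net.peakGain i ≤ 1)
    {b : Fin N} (hbs : b ≠ s) (hb : net.localGain b ≠ 0) {T : ℝ} (hT : 0 < T) :
    net.energy x T b ≤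
      ∑ j ∈ Finset.univ.erase b, (net.α * net.g b j / net.localGain b) * net.energy x T j := by
  set k := net.localGain b with hk
  set q : Fin N → ℝ := fun j => net.α * net.g b j / k with hq
  have hq0 : ∀ j ∈ Finset.univ.erase b, 0 ≤ q j := net.weight_div_localGain_nonneg b
  have hq1 : ∑ j ∈ Finset.univ.erase b, q j = 1 := net.sum_weight_div_localGain hb
  have hH := hsync.isHurwitz_localGain hgain hb
  have hyc : ∀ j, Continuous fun t => net.output (x (max t 0)) j := fun j =>
    Continuous.matrix_mulVec continuous_const ((continuous_apply j).comp hx.continuous_max)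
  set u : ℝ → Fin m → ℝ := fun t =>
    ∑ j ∈ Finset.univ.erase b, q j • net.output (x (max t 0)) j with hu
  have huc : Continuous u := by
    exact continuous_finsetSum _ fun j _ => (hyc j).const_smul (q j)
  have hmulVec : ∀ {p r : ℕ} (M : Matrix (Fin p) (Fin r) ℝ) (v : Fin r → ℝ),
      (fun i => ((M *ᵥ v) i : ℂ)) = M.map Complex.ofReal *ᵥ fun i => (v i : ℂ) := by
    intro p r M v
    ext i
    simp [Matrix.mulVec, dotProduct]
  -- Absorbing the gain `k` into the input matrix makes the transfer matrix exactly `localTransfer`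
  -- and the input the weighted mean `u`.
  have hmain := hH.integral_sum_norm_sq_le (B := (k : ℂ) • net.B.map Complex.ofReal)
    (C := net.C.map Complex.ofReal) (T := T) (x := fun t l => (x (max t 0) b l : ℂ))
    (u := fun t l => (u t l : ℂ)) ?_ hT ?_ ?_ ?_ ?_
  · have h1 : net.energy x T b = ∫ t in (0 : ℝ)..T, ∑ l,
        ‖(net.C.map Complex.ofReal *ᵥ fun l => (x (max t 0) b l : ℂ)) l‖ ^ 2 := by
      refine intervalIntegral.integral_congr fun t ht => ?_
      rw [uIcc_of_le hT.le] at ht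
      simp only [← hmulVec, max_eq_left ht.1, Complex.norm_real, output, dotProduct,
        Real.norm_eq_abs, sq, abs_mul_abs_self]
    have h2 : ∀ j, net.energy x T j = ∫ t in (0 : ℝ)..T, ∑ l,
        net.output (x (max t 0)) j l ^ 2 := by
      intro j
      refine intervalIntegral.integral_congr fun t ht => ?_
      rw [uIcc_of_le hT.le] at ht
      simp only [max_eq_left ht.1, dotProduct, sq]
    have hsqc : ∀ j, Continuous fun t => ∑ l, net.output (x (max t 0)) j l ^ 2 := by
      intro j
      have := hyc j
      fun_prop
    rw [h1]
    refine hmain.trans ?_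
    simp only [h2]
    simp_rw [← intervalIntegral.integral_const_mul]
    rw [← intervalIntegral.integral_finsetSum fun j _ =>
      ((hsqc j).const_mul (q j)).intervalIntegrable 0 T]
    refine intervalIntegral.integral_mono_on hT.le ?_ ?_ fun t _ => ?_
    · have : Continuous fun t => ∑ l, ‖(u t l : ℂ)‖ ^ 2 := by fun_prop
      exact this.intervalIntegrable 0 T
    · exact (continuous_finsetSum _ fun j _ =>
        (hsqc j).const_mul (q j)).intervalIntegrable 0 T
    · simp only [Finset.mul_sum]
      rw [Finset.sum_comm]
      refine Finset.sum_le_sum fun l _ => ?_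
      rw [Complex.norm_real, Real.norm_eq_abs, sq_abs]
      -- Jensen's inequality for the square, coordinate by coordinate.
      have hconv := (Even.convexOn_pow (𝕜 := ℝ) even_two).map_sum_le hq0 hq1
        (p := fun j => net.output (x (max t 0)) j l) (fun _ _ => mem_univ _)
      simpa [hu, Finset.sum_apply, -Finset.sum_erase_eq_sub] using hconv
  · intro ω v
    have hunit : IsUnit (net.localPencil b (ω * Complex.I)) := by
      rw [Matrix.isUnit_iff_isUnit_det, isUnit_iff_ne_zero]
      exact hH _ (by simp)
    have h1 := net.sum_norm_sq_localTransfer_le (hgain b) ω hunit v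
    rw [Matrix.mul_smul]
    exact h1
  · exact continuous_pi fun l => Complex.continuous_ofReal.comp
      ((continuous_apply l).comp ((continuous_apply b).comp hx.continuous_max))
  · fun_prop
  · intro t ht
    have h1 := hx.hasDerivAt_apply hw hbs ht.1
    rw [linearField_eq_vectorField, vectorField_apply, Pi.zero_apply, add_zero] at h1
    have h2 : ∑ j ∈ Finset.univ.erase b, (net.α * net.g b j) • net.output (x (max t 0)) j =
        k • u t := by
      rw [hu, Finset.smul_sum]
      refine Finset.sum_congr rfl fun j _ => ?_
      rw [smul_smul, hq, mul_div_cancel₀ _ hb]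
    rw [h2] at h1
    rw [hasDerivAt_pi] at h1 ⊢
    intro l
    refine (h1 l).ofReal_comp.congr_deriv ?_
    rw [Matrix.smul_mulVec, ← hmulVec, ← hmulVec, Matrix.mulVec_smul]
    simp
  · ext l
    simp [hx.2]

end IsDisturbanceResponse

theorem energy_nonneg (net : NetworkModel N n m) (x : ℝ → Fin N → Fin n → ℝ) {T : ℝ}
    (hT : 0 ≤ T) (i : Fin N) : 0 ≤ net.energy x T i :=
  intervalIntegral.integral_nonneg hT fun _ _ =>
    Finset.sum_nonneg fun _ _ => mul_self_nonneg _

theorem energy_eq_zero (net : NetworkModel N n m) {x : ℝ → Fin N → Fin n → ℝ} {T : ℝ}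
    (hT : 0 ≤ T) {i : Fin N} (h : ∀ t, 0 ≤ t → x t i = 0) : net.energy x T i = 0 := by
  rw [energy, intervalIntegral.integral_congr (g := fun _ => (0 : ℝ)),
    intervalIntegral.integral_zero]
  intro t ht
  rw [uIcc_of_le hT] at ht
  simp [output, h t ht.1]

/-- A convex combination of reals bounded by `M` that attains the value `M` puts no weight on
values below `M`. -/
theorem _root_.Finset.eq_zero_of_le_sum_mul {ι : Type*} {s : Finset ι} {q e : ι → ℝ} {M : ℝ}
    (hq : ∀ j ∈ s, 0 ≤ q j) (hq1 : ∑ j ∈ s, q j = 1) (he : ∀ j ∈ s, q j ≠ 0 → e j ≤ M)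
    (hM : M ≤ ∑ j ∈ s, q j * e j) {j : ι} (hj : j ∈ s) (hlt : q j ≠ 0 → e j < M) : q j = 0 := by
  by_contra hne
  have h1 : ∑ j ∈ s, q j * e j < ∑ j ∈ s, q j * M := by
    refine Finset.sum_lt_sum (fun i hi => ?_) ⟨j, hj, ?_⟩
    · rcases eq_or_ne (q i) 0 with h | h
      · simp [h]
      · exact mul_le_mul_of_nonneg_left (he i hi h) (hq i hi)
    · exact mul_lt_mul_of_pos_left (hlt hne) ((hq j hj).lt_of_ne' hne)
  rw [← Finset.sum_mul, hq1, one_mul] at h1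
  exact hM.not_gt h1

end NetworkModel

/-! ### The maximum principle behind a cutset. -/

theorem theorem1 {N n m : ℕ} (net : NetworkModel N n m)
    (hsync : net.SyncAsymptoticallyStable)
    (hgain : ∀ i : Fin N, net.peakGain i ≤ 1) :
    net.PropagationStable := by
  refine ⟨hsync, fun s w hw x hx VC V1 VB hcut T hT b hb => ?_⟩
  by_contra! hcon
  obtain ⟨b₀, hb₀, hmax⟩ := Finset.exists_max_image VB (net.energy x T) ⟨b, hb⟩
  set M := net.energy x T b₀ with hM
  have hMC : ∀ c ∈ VC, net.energy x T c < M := fun c hc =>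
    (Finset.le_sup' _ hc).trans_lt (hcon.trans_le (hmax b hb))
  have hMpos : 0 < M := by
    obtain ⟨c, hc⟩ := hcut.nonempty
    exact (net.energy_nonneg x hT.le c).trans_lt (hMC c hc)
  have hVB : ∀ i ∈ VB, i ∉ VC ∧ i ∉ V1 := by
    intro i hi
    have h1 : i ∈ V1 ∪ VB := Finset.mem_union_right _ hi
    rw [hcut.union, Finset.mem_compl] at h1
    exact ⟨h1, fun h => Finset.disjoint_left.1 hcut.disjoint h hi⟩
  have hsB : s ∉ VB := by
    intro h
    rcases Finset.mem_union.1 hcut.source_mem with h1 | h1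
    · exact (hVB s h).2 h1
    · exact (hVB s h).1 h1
  -- The maximisers in `VB`. An average attaining its upper bound `M` puts no weight on smaller
  -- values, so `S` receives nothing from outside itself.
  set S := VB.filter fun i => net.energy x T i = M with hS
  have hclosed : ∀ i ∈ S, ∀ j ∉ S, net.α * net.g i j = 0 := by
    intro i hi j hj
    obtain ⟨hiB, hiM⟩ := Finset.mem_filter.1 hi
    have hij : j ≠ i := fun h => hj (h ▸ hi)
    have hje : j ∈ Finset.univ.erase i := Finset.mem_erase.2 ⟨hij, Finset.mem_univ j⟩
    have hg : ∀ l ∈ Finset.univ.erase i, 0 ≤ net.g i l := fun l hl =>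
      net.g_nonneg i l (Finset.ne_of_mem_erase hl).symm
    -- With zero local gain the averaging estimate is unavailable, but then `α = 0` or every
    -- incoming weight vanishes.
    rcases eq_or_ne (net.localGain i) 0 with h0 | h0
    · rcases mul_eq_zero.1 h0 with h | h
      · rw [h, zero_mul]
      · rw [(Finset.sum_eq_zero_iff_of_nonneg hg).1 h j hje, mul_zero]
    · have his : i ≠ s := fun h => hsB (h ▸ hiB)
      have hle := hx.energy_le_sum hw hsync hgain his h0 hT
      -- Separation enters here: vertices of `V1`, whose energy is not controlled, carry no weight
      -- in the average.
      have hsrc : ∀ l ∈ Finset.univ.erase i, net.α * net.g i l / net.localGain i ≠ 0 →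
          l ∈ VC ∨ l ∈ VB := by
        intro l hl hne
        have hgl : net.g i l ≠ 0 := fun h => hne (by rw [h, mul_zero, zero_div])
        have hadj : net.graph.Adj l i :=
          ⟨Finset.ne_of_mem_erase hl, (hg l hl).lt_of_ne' hgl⟩
        by_contra! hl'
        have h1 : l ∈ V1 ∪ VB := by rw [hcut.union, Finset.mem_compl]; exact hl'.1
        rcases Finset.mem_union.1 h1 with h1 | h1
        · exact hcut.no_edge l h1 i hiB hadj
        · exact hl'.2 h1
      have hz := Finset.eq_zero_of_le_sum_mul (q := fun l => net.α * net.g i l / net.localGain i)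
        (net.weight_div_localGain_nonneg i) (net.sum_weight_div_localGain h0)
        (e := net.energy x T) (M := M)
        (fun l hl hne => (hsrc l hl hne).elim (fun h => (hMC l h).le) (hmax l))
        (hiM ▸ hle) hje (fun hne => (hsrc j hje hne).elim (hMC j) fun h =>
          (hmax j h).lt_of_ne fun h' => hj (Finset.mem_filter.2 ⟨h, h'⟩))
      exact (div_eq_zero_iff.1 hz).resolve_right h0
  have hsS : s ∉ S := fun h => hsB (Finset.mem_filter.1 h).1
  have hb₀S : b₀ ∈ S := Finset.mem_filter.2 ⟨hb₀, rfl⟩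
  refine hMpos.ne' (net.energy_eq_zero hT.le fun t ht => ?_)
  exact hx.apply_eq_zero_of_forall_weight_eq_zero hw hsS hclosed ht hb₀S
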